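/- **Setting.** A partition here has a fixed number of parts, and parts equal to $0$ are allowed and count as rows of length $0$. For a pair $(\lambda,\mu)$ of partitions and $N\ge 0$, the coinversion LLT polynomial in $X_N=\{x_1,\dots,x_N\}$ is $$\mathcal L_{(\lambda,\mu)}(X_N;t)=\sum_{(T,U)} t^{\mathrm{coinv}(T,U)}x^Tx^U\in\mathbb Z[t][x_1,\dots,x_N],$$ summed over pairs of semistandard Young tableaux $T$ of shape $\lambda$ and $U$ of shape $\mu$ with entries in $\{1,\dots,N\}$. Here $\mathrm{coinv}(T,U)$ is the number of pairs consisting of a cell $v=(i,j)$ of $\lambda$ (row $i$, column $j$) and a position $w=(r,c)$ with $1\le c\le \mu_r+1$ in some row $r$ of $\mu$ (rows of length $0$ included), such that $c-r=j-i$ and $U(r,c-1)\le T(v)\le U(r,c)$, where $U(r,0)=0$ and $U(r,\mu_r+1)=\infty$. Let $n\ge 0$ and let $\beta_1>\beta_2>\dots>\beta_{2n}\ge 0$ be integers. For each $n$-element subset $S=\{i_1<\dots<i_n\}$ of $\{1,\dots,2n\}$ with complement $\{j_1<\dots<j_n\}$, put $$\boldsymbol\beta_S=\bigl((\beta_{i_1}-n+1,\dots,\beta_{i_n}-n+n),\,(\beta_{j_1}-n+1,\dots,\beta_{j_n}-n+n)\bigr),$$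 a pair of partitions with $n$ parts each; these are $\binom{2n}{n}$ pairs. A non-crossing perfect matching of $1,\dots,2n$ is *compatible* with $S$ if each of its arcs joins an element of $S$ to an element not in $S$. **Theorem.** Let $C_n=\frac1{n+1}\binom{2n}{n}$. The non-crossing perfect matchings of $2n$ points can be listed as $M_1,\dots,M_{C_n}$, and there are integers $n_j(\boldsymbol\beta_S)$ such that for every $N$ there are polynomials $g_1,\dots,g_{C_n}\in\mathbb Z[t][x_1,\dots,x_N]$, symmetric in $x_1,\dots,x_N$ and not depending on $S$, with $$\mathcal L_{\boldsymbol\beta_S}(X_N;t)=\sum_{\substack{1\le j\le C_n\\ M_j\text{ compatible with }S}} t^{\,n_j(\boldsymbol\beta_S)}\,g_j(X_N;t)\quad\text{in }\mathbb Z[t,t^{-1}][x_1,\dots,x_N]$$ for every $n$-element subset $S$. -/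

import Mathlib

open scoped Polynomial LaurentPolynomial

noncomputable section

/-- A partition with a fixed number `m` of parts, where parts equal to zero are allowed
(and matter: they are counted as rows of length zero). -/
structure FixedPartition (m : ℕ) where
  parts : Fin m → ℕ
  antitone_parts : Antitone parts

/-- The cells of the Young diagram; rows and columns are indexed from `0`. -/
abbrev FixedPartition.Cell {m : ℕ} (lam : FixedPartition m) : Type :=
  Σ i : Fin m, Fin (lam.parts i)

/-- Semistandard fillings with entries in the alphabet `Fin N` (standing for `{1, …, N}`):
weakly increasing along rows, strictly increasing along columns. -/
def FixedPartition.IsSemistandard {m N : ℕ} (lam : FixedPartition m)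
    (T : lam.Cell → Fin N) : Prop :=
  (∀ (i : Fin m) (j j' : Fin (lam.parts i)), j ≤ j' → T ⟨i, j⟩ ≤ T ⟨i, j'⟩) ∧
  (∀ (i i' : Fin m) (j : ℕ) (hj : j < lam.parts i) (hj' : j < lam.parts i'),
    i < i' → T ⟨i, ⟨j, hj⟩⟩ < T ⟨i', ⟨j, hj'⟩⟩)

open Classical in
/-- The finite set of semistandard tableaux of shape `lam` with entries in `Fin N`. -/
def FixedPartition.ssyt {m : ℕ} (lam : FixedPartition m) (N : ℕ) :
    Finset (lam.Cell → Fin N) :=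
  Finset.univ.filter fun T => lam.IsSemistandard T

/-- The position of a triple `(u, v, w)` of the pair of straight shapes `(lam, mu)`:
`v` is a cell of the first shape, `w` is the position in row `row`, column `col` of the second
shape, on the same content line as `v`, and `u` is the position directly to the left of `w`.
Columns being counted from `0`, the range of `col` says that `w` is a cell of row `row` or the
position directly to the right of its end; `u` lies outside the shape iff `col = 0`. -/
structure LLTTriple {m m' : ℕ} (lam : FixedPartition m) (mu : FixedPartition m') where
  v : lam.Cell
  row : Fin m'
  col : Fin (mu.parts row + 1)
  content_eq : ((col : ℕ) : ℤ) - ((row : ℕ) : ℤ) = ((v.2 : ℕ) : ℤ) - ((v.1 : ℕ) : ℤ)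

/-- The triple is a coinversion triple, `a ≤ b ≤ c`, where the entry `a` of `u` is `0` and the
entry `c` of `w` is `∞` when the respective position is outside the shape. -/
def LLTTriple.IsCoinversion {m m' N : ℕ} {lam : FixedPartition m} {mu : FixedPartition m'}
    (τ : LLTTriple lam mu) (T : lam.Cell → Fin N) (U : mu.Cell → Fin N) : Prop :=
  (∀ (c : ℕ) (hc : c < mu.parts τ.row), (τ.col : ℕ) = c + 1 → U ⟨τ.row, ⟨c, hc⟩⟩ ≤ T τ.v) ∧
  (∀ hc : (τ.col : ℕ) < mu.parts τ.row, T τ.v ≤ U ⟨τ.row, ⟨τ.col, hc⟩⟩)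

/-- The number of coinversion triples of the pair of fillings `(T, U)`. -/
def coinv {m m' N : ℕ} {lam : FixedPartition m} {mu : FixedPartition m'}
    (T : lam.Cell → Fin N) (U : mu.Cell → Fin N) : ℕ :=
  Nat.card {τ : LLTTriple lam mu // τ.IsCoinversion T U}

/-- The coinversion LLT polynomial of the pair of straight shapes `(lam, mu)` in `N` variables,
as a polynomial in `x₁, …, x_N` with coefficients in `ℤ[t]`. -/
def LLT (N : ℕ) {m m' : ℕ} (lam : FixedPartition m) (mu : FixedPartition m') :
    MvPolynomial (Fin N) ℤ[X] :=
  ∑ T ∈ lam.ssyt N, ∑ U ∈ mu.ssyt N,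
    MvPolynomial.C (Polynomial.X ^ coinv T U) *
      ((∏ c : lam.Cell, MvPolynomial.X (T c)) * ∏ c : mu.Cell, MvPolynomial.X (U c))

/-- Extension of scalars from `ℤ[t]` to `ℤ[t, t⁻¹]`. -/
def toLaurentCoeffs (N : ℕ) :
    MvPolynomial (Fin N) ℤ[X] →+* MvPolynomial (Fin N) ℤ[T;T⁻¹] :=
  MvPolynomial.map Polynomial.toLaurent

/-- A choice of the `n` indices `i₁ < … < iₙ` among the `2n` available ones. -/
abbrev HalfSubset (n : ℕ) : Type := {S : Finset (Fin (2 * n)) // S.card = n}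

/-- The complementary indices `j₁ < … < jₙ`. -/
def HalfSubset.compl {n : ℕ} (S : HalfSubset n) : HalfSubset n :=
  ⟨S.1ᶜ, by rw [Finset.card_compl, Fintype.card_fin, S.2]; omega⟩

theorem famPart_aux {n : ℕ} (β : Fin (2 * n) → ℕ) (hβ : StrictAnti β) (S : HalfSubset n) :
    Antitone fun k : Fin n => β (S.1.orderEmbOfFin S.2 k) + (k + 1) - n := by
  cases n with
  | zero => intro a; exact a.elim0
  | succ n =>
    refine Fin.antitone_iff_succ_le.2 fun k => ?_
    have h : β (S.1.orderEmbOfFin S.2 k.succ) < β (S.1.orderEmbOfFin S.2 k.castSucc) :=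
      hβ ((S.1.orderEmbOfFin S.2).strictMono Fin.castSucc_lt_succ)
    simp only [Fin.val_succ, Fin.val_castSucc]
    omega

/-- The partition `(β_{i₁} - n + 1, …, β_{iₙ} - n + n)` for the index set
`S = {i₁ < … < iₙ}`. As `β_{i_k} ≥ n - k`, the subtraction never truncates. -/
def famPart {n : ℕ} (β : Fin (2 * n) → ℕ) (hβ : StrictAnti β) (S : HalfSubset n) :
    FixedPartition n where
  parts k := β (S.1.orderEmbOfFin S.2 k) + (k + 1) - n
  antitone_parts := famPart_aux β hβ S

/-- A non-crossing perfect matching of `2n` points on a line: every point `i` is joined by an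
arc to `partner i`, and no two arcs `{i, partner i}`, `{j, partner j}` satisfy
`i < j < partner i < partner j`. -/
@[ext]
structure NoncrossingMatching (n : ℕ) where
  partner : Fin (2 * n) → Fin (2 * n)
  partner_partner : ∀ i, partner (partner i) = i
  partner_ne : ∀ i, partner i ≠ i
  noncrossing : ∀ i j, i < j → j < partner i → ¬ partner i < partner j

/-- The matching is compatible with the coloring of the points by membership in `S`:
every arc joins points of different colors. -/
def NoncrossingMatching.Compatible {n : ℕ} (M : NoncrossingMatching n) (S : HalfSubset n) :
    Prop :=
  ∀ i, M.partner i ∈ S.1 ↔ i ∉ S.1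

instance {n : ℕ} (M : NoncrossingMatching n) (S : HalfSubset n) :
    Decidable (M.Compatible S) := by
  unfold NoncrossingMatching.Compatible
  infer_instance

end

/-!
The LLT polynomial of the pair `β_S` is the partition function of a two-colour vertex model whose
top boundary is the colour word of `S` and in whose bottom boundary both colours sit at the same
sites. The row operators of the model commute with each other, by a Yang–Baxter equation, which
makes the partition function symmetric; and they commute with the raising operator of `U_q(sl₂)`
exchanging the two colours, which kills the bottom boundary. Hence the partition functions, as a
function of the colour word `z ∈ {0,1}^{2n}`, form a vector killed by the raising operator.

Each non-crossing matching carries such a vector too: it is a power of `t` on the words compatible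
with the matching and zero elsewhere. A vector killed by the raising operator vanishes as soon as
it does so on the words of right end points of the matchings, and on these words the vectors of the
matchings form a triangular matrix with powers of `t` on the diagonal. So the partition functions
are combinations of the vectors of the matchings, with coefficients given by the adjugate of that
matrix.
-/

section MatrixProduct

open Matrix Kronecker

variable {A : Type*} [CommSemiring A] {Q B C : Type*} [Fintype B] [DecidableEq B]
  [Fintype C] [DecidableEq C]

/-- The matrix product operator with local tensor `θ`: the entry of the operator on `K` sites
between the states `S` and `S'` is itself a matrix, acting on the auxiliary space `B`. -/
def mpo (θ : Q → Q → Matrix B B A) {K : ℕ} (S S' : Fin K → Q) : Matrix B B A :=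
  (List.ofFn fun p => θ (S p) (S' p)).prod

theorem mpo_zero (θ : Q → Q → Matrix B B A) (S S' : Fin 0 → Q) : mpo θ S S' = 1 := by
  simp only [mpo, List.ofFn_zero, List.prod_nil]

theorem mpo_cons (θ : Q → Q → Matrix B B A) {K : ℕ} (s s' : Q) (S S' : Fin K → Q) :
    mpo θ (Fin.cons s S : Fin (K + 1) → Q) (Fin.cons s' S' : Fin (K + 1) → Q) =
      θ s s' * mpo θ S S' := by
  simp only [mpo, List.ofFn_succ, Fin.cons_zero, Fin.cons_succ, List.prod_cons]

theorem sum_fin_cons [Fintype Q] {M : Type*} [AddCommMonoid M] {K : ℕ}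
    (f : (Fin (K + 1) → Q) → M) :
    ∑ S, f S = ∑ s, ∑ S, f (Fin.cons s S) := by
  rw [← (Fin.consEquiv fun _ => Q).sum_comp, Fintype.sum_prod_type]
  rfl

theorem sum_kronecker_prod_ofFn [Fintype Q] : ∀ {K : ℕ} (a : Fin K → Q → Matrix B B A)
    (b : Fin K → Q → Matrix C C A),
    ∑ S : Fin K → Q, (List.ofFn fun p => a p (S p)).prod ⊗ₖ (List.ofFn fun p => b p (S p)).prod =
      (List.ofFn fun p => ∑ m, a p m ⊗ₖ b p m).prod
  | 0, a, b => by simp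
  | K + 1, a, b => by
    rw [sum_fin_cons, List.ofFn_succ, List.prod_cons,
      ← sum_kronecker_prod_ofFn (fun p => a p.succ) (fun p => b p.succ), Finset.sum_mul_sum]
    simp [List.ofFn_succ, mul_kronecker_mul]

theorem semiconjBy_prod_ofFn {M : Type*} [Monoid M] {r : M} : ∀ {K : ℕ} {a b : Fin K → M},
    (∀ p, SemiconjBy r (a p) (b p)) → SemiconjBy r (List.ofFn a).prod (List.ofFn b).prod
  | 0, _, _, _ => by simp
  | K + 1, _, _, h => by
    simpa only [List.ofFn_succ, List.prod_cons] using
      (h 0).mul_right (semiconjBy_prod_ofFn fun p => h p.succ)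

/-- The train argument: an intertwiner of the local tensors is moved through all the sites. -/
theorem mpo_exchange [Fintype Q] (θ : Q → Q → Matrix B B A) (ξ : Q → Q → Matrix C C A)
    (R : Matrix (B × C) (B × C) A) {i i' : B} {c c' : C} {r : A}
    (hR : ∀ s s', SemiconjBy R (∑ m, θ s m ⊗ₖ ξ m s') (∑ m, θ m s' ⊗ₖ ξ s m))
    (hrow : R (i, c) = Pi.single (i, c) r) (hcol : R.col (i', c') = Pi.single (i', c') r)
    {K : ℕ} (S S' : Fin K → Q) :
    r * ∑ m, mpo θ S m i i' * mpo ξ m S' c c' = r * ∑ m, mpo ξ S m c c' * mpo θ m S' i i' := by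
  have h : R * ∑ m, mpo θ S m ⊗ₖ mpo ξ m S' = (∑ m, mpo θ m S' ⊗ₖ mpo ξ S m) * R := by
    simp only [mpo]
    rw [sum_kronecker_prod_ofFn (fun p m => θ (S p) m) (fun p m => ξ m (S' p)),
      sum_kronecker_prod_ofFn (fun p m => θ m (S' p)) (fun p m => ξ (S p) m)]
    exact semiconjBy_prod_ofFn fun p => hR (S p) (S' p)
  have hentry := congrFun (congrFun h (i, c)) (i', c')
  have hcol' (k) : R k (i', c') = (Pi.single (i', c') r : B × C → A) k := congrFun hcol k
  simp only [Matrix.mul_apply, hrow, hcol', Pi.single_apply, ite_mul, mul_ite, zero_mul,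
    mul_zero, Finset.sum_ite_eq', Finset.mem_univ, if_true, Matrix.sum_apply,
    kroneckerMap_apply] at hentry
  rw [hentry, mul_comm]
  simp only [mul_comm (mpo θ _ _ _ _)]

end MatrixProduct

section FormalOperators

/-- Formal operators on the free module with basis `ι`, with coefficients in `ℤ[x, y, t]`: an
entry `(c, (i, j, k), a)` of `f b` stands for the contribution `c * x ^ i * y ^ j * t ^ k` to the
matrix entry at `(b, a)`. They serve to decide identities between sparse explicit matrices by
evaluation. -/
abbrev FormalOp (ι : Type*) : Type _ := ι → List (ℤ × (ℕ × ℕ × ℕ) × ι)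

namespace FormalOp

variable {ι I J S : Type*}

/-- The composition of formal operators, in the order of the product of their matrices. -/
def comp (f g : FormalOp ι) : FormalOp ι := fun b =>
  (f b).flatMap fun u => (g u.2.2).map fun v => (u.1 * v.1, u.2.1 + v.2.1, v.2.2)

/-- The action of a formal operator on the first two of three tensor factors. -/
def lift₁₂ (f : FormalOp (I × J)) : FormalOp (I × J × S) := fun b =>
  (f (b.1, b.2.1)).map fun u => (u.1, u.2.1, u.2.2.1, u.2.2.2, b.2.2)

/-- The action of a formal operator on the first and the last of three tensor factors. -/
def lift₁₃ (f : FormalOp (I × S)) : FormalOp (I × J × S) := fun b =>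
  (f (b.1, b.2.2)).map fun u => (u.1, u.2.1, u.2.2.1, b.2.1, u.2.2.2)

/-- The action of a formal operator on the last two of three tensor factors. -/
def lift₂₃ (f : FormalOp (J × S)) : FormalOp (I × J × S) := fun b =>
  (f b.2).map fun u => (u.1, u.2.1, b.1, u.2.2)

/-- Equality of formal operators after collecting equal monomials. -/
def Equiv [DecidableEq ι] (f g : FormalOp ι) : Prop :=
  ∀ b, ∀ m ∈ (f b ++ g b).map Prod.snd,
    (((f b).filter (·.2 = m)).map Prod.fst).sum = (((g b).filter (·.2 = m)).map Prod.fst).sum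

instance [DecidableEq ι] [Fintype ι] (f g : FormalOp ι) : Decidable (Equiv f g) := by
  unfold Equiv
  infer_instance

variable {A : Type*} [CommRing A] (x y t : A)

/-- The value of the monomial with the exponents `e` in the three variables. -/
def monomialValue (e : ℕ × ℕ × ℕ) : A := x ^ e.1 * y ^ e.2.1 * t ^ e.2.2

theorem monomialValue_add (e e' : ℕ × ℕ × ℕ) :
    monomialValue x y t (e + e') = monomialValue x y t e * monomialValue x y t e' := by
  simp only [monomialValue, Prod.fst_add, Prod.snd_add, pow_add]
  ring

/-- The matrix of a formal operator. -/
def toMatrix [DecidableEq ι] (f : FormalOp ι) : Matrix ι ι A :=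
  .of fun b a => ((f b).map fun u => u.1 * if u.2.2 = a then monomialValue x y t u.2.1 else 0).sum

theorem sum_map_eq_sum_coeff {κ : Type*} [DecidableEq κ] (w : κ → A) (s : Finset κ) :
    ∀ l : List (ℤ × κ), (∀ u ∈ l, u.2 ∈ s) →
    (l.map fun u => u.1 * w u.2).sum =
      ∑ m ∈ s, (((l.filter (·.2 = m)).map Prod.fst).sum : ℤ) * w m
  | [], _ => by simp
  | u :: l, h => by
    have hu : ∀ m, ((((u :: l).filter (·.2 = m)).map Prod.fst).sum : ℤ) =
        (if u.2 = m then u.1 else 0) + ((l.filter (·.2 = m)).map Prod.fst).sum := by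
      intro m
      by_cases hm : u.2 = m <;> simp [hm]
    simp only [List.map_cons, List.sum_cons,
      sum_map_eq_sum_coeff w s l fun v hv => h v (List.mem_cons_of_mem u hv), hu, Int.cast_add,
      add_mul, Finset.sum_add_distrib, Int.cast_ite, Int.cast_zero, ite_mul, zero_mul,
      Finset.sum_ite_eq, h u List.mem_cons_self, if_true]

variable [DecidableEq ι] [DecidableEq I] [DecidableEq J] [DecidableEq S]

theorem Equiv.toMatrix_eq {f g : FormalOp ι} (h : Equiv f g) :
    toMatrix x y t f = toMatrix x y t g := by
  ext b a
  let s := ((f b ++ g b).map Prod.snd).toFinset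
  have hs : ∀ u ∈ f b ++ g b, u.2 ∈ s := fun u hu =>
    List.mem_toFinset.2 (List.mem_map_of_mem hu)
  let w : (ℕ × ℕ × ℕ) × ι → A := fun m =>
    if m.2 = a then monomialValue x y t m.1 else 0
  calc
    _ = ∑ m ∈ s, ((((f b).filter (·.2 = m)).map Prod.fst).sum : ℤ) * w m :=
      sum_map_eq_sum_coeff w s (f b) fun u hu => hs u (List.mem_append_left _ hu)
    _ = ∑ m ∈ s, ((((g b).filter (·.2 = m)).map Prod.fst).sum : ℤ) * w m :=
      Finset.sum_congr rfl fun m hm => by rw [h b m (List.mem_toFinset.1 hm)]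
    _ = _ := (sum_map_eq_sum_coeff w s (g b) fun u hu => hs u (List.mem_append_right _ hu)).symm

theorem toMatrix_comp [Fintype ι] (f g : FormalOp ι) :
    toMatrix x y t (comp f g) = toMatrix x y t f * toMatrix x y t g := by
  ext b a
  simp only [comp, toMatrix, Matrix.mul_apply, Matrix.of_apply, List.map_flatMap, List.map_map,
    Function.comp_def]
  induction f b with
  | nil => simp
  | cons u l ih =>
    have hu (v : ℤ × (ℕ × ℕ × ℕ) × ι) : ((u.1 * v.1 : ℤ) : A) *
        (if v.2.2 = a then monomialValue x y t (u.2.1 + v.2.1) else 0) =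
        u.1 * monomialValue x y t u.2.1 *
          (v.1 * if v.2.2 = a then monomialValue x y t v.2.1 else 0) := by
      rw [monomialValue_add]
      push_cast
      split_ifs <;> ring
    simp only [List.flatMap_cons, List.sum_append, ih, hu, List.sum_map_mul_left, List.map_cons,
      List.sum_cons, add_mul, Finset.sum_add_distrib]
    simp

theorem toMatrix_lift₁₂ (f : FormalOp (I × J)) (b a : I × J × S) :
    toMatrix x y t (lift₁₂ f) b a =
      if b.2.2 = a.2.2 then toMatrix x y t f (b.1, b.2.1) (a.1, a.2.1) else 0 := by
  simp only [toMatrix, lift₁₂, Matrix.of_apply, List.map_map, Function.comp_def, Prod.ext_iff]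
  split_ifs with h <;> simp [h]

theorem toMatrix_lift₁₃ (f : FormalOp (I × S)) (b a : I × J × S) :
    toMatrix x y t (lift₁₃ f) b a =
      if b.2.1 = a.2.1 then toMatrix x y t f (b.1, b.2.2) (a.1, a.2.2) else 0 := by
  simp only [toMatrix, lift₁₃, Matrix.of_apply, List.map_map, Function.comp_def, Prod.ext_iff]
  split_ifs with h <;> simp [h]

theorem toMatrix_lift₂₃ (f : FormalOp (J × S)) (b a : I × J × S) :
    toMatrix x y t (lift₂₃ f) b a = if b.1 = a.1 then toMatrix x y t f b.2 a.2 else 0 := by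
  simp only [toMatrix, lift₂₃, Matrix.of_apply, List.map_map, Function.comp_def, Prod.ext_iff]
  split_ifs with h <;> simp [h]

/-- A formal operator on an edge and a site, as a local tensor with the edge as auxiliary space. -/
def tensor (f : FormalOp (I × S)) (s s' : S) : Matrix I I A :=
  .of fun b b' => toMatrix x y t f (b, s) (b', s')

open Matrix Kronecker in
/-- The Yang–Baxter equation on three tensor factors is the exchange relation of `mpo_exchange`. -/
theorem semiconjBy_tensor [Fintype I] [Fintype J] [Fintype S] {r : FormalOp (I × J)}
    {f : FormalOp (I × S)} {g : FormalOp (J × S)}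
    (h : Equiv (comp (lift₁₂ r) (comp (lift₁₃ f) (lift₂₃ g)))
      (comp (lift₂₃ g) (comp (lift₁₃ f) (lift₁₂ r)))) (s s' : S) :
    SemiconjBy (toMatrix x y t r) (∑ m, tensor x y t f s m ⊗ₖ tensor x y t g m s')
      (∑ m, tensor x y t f m s' ⊗ₖ tensor x y t g s m) := by
  ext ⟨i, j⟩ ⟨i', j'⟩
  have hentry := congrFun (congrFun (h.toMatrix_eq x y t) (i, j, s)) (i', j', s')
  simp only [toMatrix_comp, Matrix.mul_apply, toMatrix_lift₁₂, toMatrix_lift₁₃, toMatrix_lift₂₃,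
    Fintype.sum_prod_type, ite_mul, mul_ite, zero_mul, mul_zero, Finset.sum_ite_eq,
    Finset.sum_ite_eq', Finset.sum_ite_irrel, Finset.sum_const_zero, Finset.mem_univ,
    if_true, Finset.mul_sum] at hentry
  simp only [Matrix.mul_apply, Matrix.sum_apply, kroneckerMap_apply, Fintype.sum_prod_type, tensor,
    Matrix.of_apply, Finset.mul_sum, Finset.sum_mul]
  rw [hentry, Finset.sum_comm_cycle]
  exact Finset.sum_congr rfl fun _ _ => Finset.sum_congr rfl fun _ _ =>
    Finset.sum_congr rfl fun _ _ => by ring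

end FormalOp

end FormalOperators

section LocalWeights

/-- The occupation of a site or of a horizontal edge by particles of the two colours. -/
abbrev Occ : Type := Bool × Bool

/-- The state without particles. -/
abbrev Occ.empty : Occ := (false, false)

/-- The ice rule for one colour: at most one particle enters a vertex, through the left edge `b` or
from the site `s` below, and it leaves upwards through `s'` or to the right through `b'`. -/
def Conserves (b s s' b' : Bool) : Prop :=
  b.toNat + s.toNat ≤ 1 ∧ b.toNat + s.toNat = s'.toNat + b'.toNat

instance (b s s' b' : Bool) : Decidable (Conserves b s s' b') := by
  unfold Conserves
  infer_instance

variable {A : Type*} [CommRing A] (x y t : A)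

/-- The local weight of the vertex model: a factor `x` for every particle leaving to the right, and
a factor `t` if the first colour does so in the presence of the second. -/
def lax (s s' : Occ) : Matrix Occ Occ A :=
  .of fun b b' =>
    if Conserves b.1 s.1 s'.1 b'.1 ∧ Conserves b.2 s.2 s'.2 b'.2 then
      x ^ (b'.1.toNat + b'.2.toNat) * t ^ (b'.1 && (b.2 || s.2)).toNat
    else 0

/-- The factor that the raising operator picks up at the sites to the left of its action. -/
def cartan (s : Occ) : A := (-1) ^ (s.1.toNat + s.2.toNat) * t ^ s.1.toNat

/-- The local tensor of the operator replacing one particle of the second colour by one of the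
first; the auxiliary state tells whether the replacement has already happened. -/
def raiseTensor (s s' : Occ) : Matrix Bool Bool A :=
  .of fun
  | false, false => if s = s' then cartan t s else 0
  | false, true => if s = (false, true) ∧ s' = (true, false) then 1 else 0
  | true, false => 0
  | true, true => if s = s' then 1 else 0

namespace FormalOp

/-- The vertices of one colour obeying the ice rule, from the left edge and the site below to the
right edge and the site above. -/
def vertexMoves : Bool → Bool → List (Bool × Bool)
  | false, false => [(false, false)]
  | true, true => []
  | _, _ => [(true, false), (false, true)]

/-- The operator of the local weights with the spectral parameter `x ^ p.1 * y ^ p.2`. -/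
def lax (p : ℕ × ℕ) : FormalOp (Occ × Occ) := fun b =>
  (vertexMoves b.1.1 b.2.1).flatMap fun u => (vertexMoves b.1.2 b.2.2).map fun v =>
    (1, ((u.1.toNat + v.1.toNat) * p.1, (u.1.toNat + v.1.toNat) * p.2,
      (u.1 && (b.1.2 || b.2.2)).toNat), (u.1, v.1), (u.2, v.2))

/-- The crossing of two horizontal lines with parameters `l` and `r` for one colour; the weight of
two particles passing each other is `l - r`. -/
def crossMoves (l r : ℕ × ℕ × ℕ) : Bool × Bool → List (ℤ × (ℕ × ℕ × ℕ) × Bool × Bool)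
  | (false, false) => [(1, l, false, false)]
  | (true, true) => [(1, r, true, true)]
  | (false, true) => [(1, l, true, false)]
  | (true, false) => [(1, r, false, true), (1, l, true, false), (-1, r, true, false)]

/-- The crossing of two horizontal lines with the spectral parameters `x` and `y`. -/
def cross : FormalOp (Occ × Occ) := fun b =>
  (crossMoves (1, 0, 0) (0, 1, 0) (b.1.2, b.2.2)).flatMap fun u =>
    (crossMoves (1, 0, 1) (0, 1, if b.1.2 && !b.2.2 && u.2.2.1 && !u.2.2.2 then 0 else 1)
      (b.1.1, b.2.1)).map fun v =>
        (u.1 * v.1, u.2.1 + v.2.1, (v.2.2.1, u.2.2.1), (v.2.2.2, u.2.2.2))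

theorem yangBaxter_cross_lax :
    Equiv (comp (lift₁₂ cross) (comp (lift₁₃ (lax (1, 0))) (lift₂₃ (lax (0, 1)))))
      (comp (lift₂₃ (lax (0, 1))) (comp (lift₁₃ (lax (1, 0))) (lift₁₂ cross))) := by
  decide +kernel

/-- The operator of the raising tensor. -/
def raise : FormalOp (Bool × Occ)
  | (true, s) => [(1, 0, true, s)]
  | (false, s) => ((-1) ^ (s.1.toNat + s.2.toNat), (0, 0, s.1.toNat), false, s) ::
      if s = (false, true) then [(1, 0, true, true, false)] else []

theorem yangBaxter_raise_lax :
    Equiv (comp (lift₁₂ raise) (comp (lift₁₃ raise) (lift₂₃ (lax (1, 0)))))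
      (comp (lift₂₃ (lax (1, 0))) (comp (lift₁₃ raise) (lift₁₂ raise))) := by
  decide +kernel

theorem tensor_lax_left (s s' : Occ) : tensor x y t (lax (1, 0)) s s' = _root_.lax x t s s' := by
  revert s s'
  simp only [← Matrix.ext_iff, Prod.forall, Bool.forall_bool]
  simp [tensor, toMatrix, lax, vertexMoves, monomialValue, _root_.lax, Conserves]

theorem tensor_lax_right (s s' : Occ) : tensor x y t (lax (0, 1)) s s' = _root_.lax y t s s' := by
  revert s s'
  simp only [← Matrix.ext_iff, Prod.forall, Bool.forall_bool]
  simp [tensor, toMatrix, lax, vertexMoves, monomialValue, _root_.lax, Conserves]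

theorem tensor_raise (s s' : Occ) : tensor x y t raise s s' = raiseTensor t s s' := by
  revert s s'
  simp only [← Matrix.ext_iff, Prod.forall, Bool.forall_bool]
  simp [tensor, toMatrix, raise, monomialValue, raiseTensor, cartan]

theorem toMatrix_cross_empty_row :
    toMatrix x y t cross (Occ.empty, Occ.empty) =
      Pi.single (Occ.empty, Occ.empty) (x * (x * t)) := by
  simp only [funext_iff, Prod.forall, Bool.forall_bool]
  simp [toMatrix, cross, crossMoves, monomialValue]
  ring

theorem toMatrix_cross_empty_col :
    (toMatrix x y t cross).col (Occ.empty, Occ.empty) =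
      Pi.single (Occ.empty, Occ.empty) (x * (x * t)) := by
  simp only [funext_iff, Prod.forall, Bool.forall_bool]
  simp [toMatrix, cross, crossMoves, monomialValue]
  ring

theorem toMatrix_raise_row :
    toMatrix x y t raise (false, Occ.empty) = Pi.single (false, Occ.empty) 1 := by
  simp only [funext_iff, Prod.forall, Bool.forall_bool]
  simp [toMatrix, raise, monomialValue]

theorem toMatrix_raise_col :
    (toMatrix x y t raise).col (true, Occ.empty) = Pi.single (true, Occ.empty) 1 := by
  simp only [funext_iff, Prod.forall, Bool.forall_bool]
  simp [toMatrix, raise, monomialValue]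

end FormalOp

end LocalWeights

section TransferOperators

open Matrix

variable {A : Type*} [CommRing A] (x y t : A)

/-- The row transfer operator of the vertex model on `K` sites. -/
def rowOp (K : ℕ) : Matrix (Fin K → Occ) (Fin K → Occ) A :=
  .of fun S S' => mpo (lax x t) S S' Occ.empty Occ.empty

/-- The raising operator of `U_q(sl₂)` exchanging the two colours, acting on `K` sites. -/
def raiseOp (K : ℕ) : Matrix (Fin K → Occ) (Fin K → Occ) A :=
  .of fun S S' => mpo (raiseTensor t) S S' false true

/-- The partition function of the vertex model with row parameters `x` and the given boundary
states. -/
def partitionFun {N : ℕ} (x : Fin N → A) {K : ℕ} : Matrix (Fin K → Occ) (Fin K → Occ) A :=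
  (List.ofFn fun i => rowOp (x i) t K).prod

variable {x y t} in
theorem rowOp_comm [IsDomain A] (hx : x ≠ 0) (ht : t ≠ 0) (K : ℕ) :
    Commute (rowOp x t K) (rowOp y t K) := by
  have hR (s s' : Occ) := FormalOp.semiconjBy_tensor x y t FormalOp.yangBaxter_cross_lax s s'
  simp only [FormalOp.tensor_lax_left, FormalOp.tensor_lax_right] at hR
  ext S S'
  exact mul_left_cancel₀ (mul_ne_zero hx (mul_ne_zero hx ht))
    (mpo_exchange _ _ _ hR (FormalOp.toMatrix_cross_empty_row x y t)
      (FormalOp.toMatrix_cross_empty_col x y t) S S')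

theorem raiseOp_comm_rowOp (K : ℕ) : Commute (raiseOp t K) (rowOp x t K) := by
  have hR (s s' : Occ) := FormalOp.semiconjBy_tensor x 0 t FormalOp.yangBaxter_raise_lax s s'
  simp only [FormalOp.tensor_lax_left, FormalOp.tensor_raise] at hR
  ext S S'
  have h := mpo_exchange _ _ _ hR (FormalOp.toMatrix_raise_row x 0 t)
    (FormalOp.toMatrix_raise_col x 0 t) S S'
  rwa [one_mul, one_mul] at h

variable {t} in
theorem partitionFun_comp_perm [IsDomain A] {N : ℕ} {x : Fin N → A} (hx : ∀ i, x i ≠ 0)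
    (ht : t ≠ 0) {K : ℕ} (e : Equiv.Perm (Fin N)) :
    partitionFun t (x ∘ e) = partitionFun t x (K := K) :=
  (Equiv.Perm.ofFn_comp_perm e fun i => rowOp (x i) t K).prod_eq' <|
    List.pairwise_ofFn.2 fun _ _ _ => rowOp_comm (hx _) ht K

theorem raiseOp_comm_partitionFun {N : ℕ} (x : Fin N → A) (K : ℕ) :
    Commute (raiseOp t K) (partitionFun t x) :=
  Commute.list_prod_right _ _ <|
    List.forall_mem_ofFn_iff.2 fun i => raiseOp_comm_rowOp (x i) t K

theorem mpo_raiseTensor_true_true {K : ℕ} (S S' : Fin K → Occ) :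
    mpo (raiseTensor t) S S' true true = if S = S' then 1 else 0 := by
  induction K with
  | zero => simp [mpo_zero, Subsingleton.elim S S']
  | succ K ih =>
    cases S using Fin.consCases with | _ s S
    cases S' using Fin.consCases with | _ s' S'
    simp [mpo_cons, Matrix.mul_apply, ih, raiseTensor, Fin.cons_inj, ← ite_and, and_comm]

theorem raiseOp_cons {K : ℕ} (s s' : Occ) (S S' : Fin K → Occ) :
    raiseOp t (K + 1) (Fin.cons s S) (Fin.cons s' S') =
      (if S = S' then if s = (false, true) ∧ s' = (true, false) then 1 else 0 else 0) +
        if s = s' then cartan t s * raiseOp t K S S' else 0 := by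
  simp [raiseOp, mpo_cons, Matrix.mul_apply, mpo_raiseTensor_true_true, raiseTensor]

theorem vecMul_raiseOp_apply {K : ℕ} (ψ : (Fin K → Occ) → A) (S : Fin K → Occ) :
    (ψ ᵥ* raiseOp t K) S =
      ∑ i with S i = (true, false), (∏ p with p < i, cartan t (S p)) *
        ψ (Function.update S i (false, true)) := by
  induction K with
  | zero => simp [Matrix.vecMul, dotProduct, raiseOp, mpo_zero]
  | succ K ih =>
    cases S using Fin.consCases with | _ s S
    have htail := ih (fun S' => cartan t s * ψ (Fin.cons s S')) S
    simp only [Matrix.vecMul, dotProduct, Finset.sum_filter, Finset.prod_filter] at htail ⊢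
    rw [sum_fin_cons, Fin.sum_univ_succ]
    simp only [raiseOp_cons, mul_add, mul_ite, mul_one, mul_zero, Finset.sum_add_distrib,
      Finset.sum_ite_eq', Finset.mem_univ, if_true, Fin.cons_zero, Fin.cons_succ,
      Fin.update_cons_zero]
    congr 1
    · simp [ite_and]
    · rw [Finset.sum_comm]
      simp only [Finset.sum_ite_eq', Finset.mem_univ, if_true, Fin.prod_univ_succ, Fin.succ_pos,
        Fin.cons_zero, Fin.cons_succ, Fin.succ_lt_succ_iff, ← Fin.cons_update, mul_assoc,
        mul_left_comm _ (cartan t s)] at htail ⊢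
      exact htail

/-- A boundary state in which both colours occupy the same sites. -/
def ColorBalanced {K : ℕ} (S : Fin K → Occ) : Prop := ∀ p, (S p).1 = (S p).2

theorem ColorBalanced.raiseOp_apply {K : ℕ} {S : Fin K → Occ} (hS : ColorBalanced S)
    (S' : Fin K → Occ) : raiseOp t K S S' = 0 := by
  induction K with
  | zero => simp [raiseOp, mpo_zero]
  | succ K ih =>
    cases S using Fin.consCases with | _ s S
    cases S' using Fin.consCases with | _ s' S'
    have hs : s ≠ (false, true) := by
      rintro rfl
      simpa using hS 0
    simp [raiseOp_cons, hs, ih (S := S) fun p => by simpa using hS p.succ]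

theorem ColorBalanced.sum_cartan_mul_partitionFun {K : ℕ} {S₀ : Fin K → Occ}
    (hS₀ : ColorBalanced S₀) {N : ℕ} (x : Fin N → A) (S : Fin K → Occ) :
    ∑ i with S i = (true, false), (∏ p with p < i, cartan t (S p)) *
      partitionFun t x S₀ (Function.update S i (false, true)) = 0 := by
  rw [← vecMul_raiseOp_apply t (partitionFun t x S₀)]
  have hcomm := congrFun₂ (raiseOp_comm_partitionFun t x K).eq S₀ S
  rw [Matrix.mul_apply_eq_vecMul, Matrix.mul_apply_eq_vecMul] at hcomm
  rw [← hcomm, show raiseOp t K S₀ = 0 from funext (hS₀.raiseOp_apply t), Matrix.zero_vecMul,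
    Pi.zero_apply]

end TransferOperators

theorem conserves_iff {b s s' b' : Bool} :
    Conserves b s s' b' ↔ ¬(b = true ∧ s = true) ∧ ¬(s' = true ∧ b' = true) ∧
      (b = true ∨ s = true ↔ s' = true ∨ b' = true) := by
  revert b s s' b'
  decide

theorem Conserves.left_eq_false {b s s' b' : Bool} (h : Conserves b s s' b') (hs : s = true) :
    b = false := by
  simpa [hs] using (conserves_iff.1 h).1

theorem count_eq_add_of_conserves {a b e : ℕ → Bool} {K : ℕ} (h0 : e 0 = false)
    (he : ∀ p < K, Conserves (e p) (a p) (b p) (e (p + 1))) {p : ℕ} (hp : p ≤ K) :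
    Nat.count (a · = true) p = Nat.count (b · = true) p + (e p).toNat := by
  induction p with
  | zero => simp [h0]
  | succ p ih =>
    have hcount (c : Bool) : (if c = true then 1 else 0) = c.toNat := by cases c <;> rfl
    have hp' := ih (by omega)
    have hcons := (he p hp).2
    rw [Nat.count_succ, Nat.count_succ, hcount, hcount]
    omega

theorem sub_le_apply_of_strictAnti {m : ℕ} {f : Fin m → ℕ} (hf : StrictAnti f) (i : Fin m) :
    m - 1 - i ≤ f i := by
  simpa using Finset.card_le_card_of_injOn (s := Finset.Ioi i) (t := Finset.range (f i)) f
    (fun j hj => by simpa using hf (Finset.mem_Ioi.1 hj)) hf.injective.injOn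

namespace FixedPartition

variable {m : ℕ}

theorem parts_injective : Function.Injective (parts : FixedPartition m → Fin m → ℕ) := by
  rintro ⟨p, _⟩ ⟨q, _⟩ rfl
  rfl

/-- The position of the particle that stands for a row, when the partition is encoded as a set of
`m` occupied sites. -/
def pos (lam : FixedPartition m) (i : Fin m) : ℕ := lam.parts i + (m - 1 - i)

theorem strictAnti_pos (lam : FixedPartition m) : StrictAnti lam.pos := by
  intro i j h
  have hparts := lam.antitone_parts h.le
  have : (i : ℕ) < j := h
  simp only [pos]
  omega

/-- The partition with prescribed positions. -/
def ofPos (f : Fin m → ℕ) (hf : StrictAnti f) : FixedPartition m where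
  parts i := f i - (m - 1 - i)
  antitone_parts := by
    cases m with
    | zero => exact fun i => i.elim0
    | succ m =>
      refine Fin.antitone_iff_succ_le.2 fun i => ?_
      have hi : f i.succ < f i.castSucc := hf Fin.castSucc_lt_succ
      simp only [Fin.val_succ, Fin.val_castSucc]
      omega

theorem pos_ofPos (f : Fin m → ℕ) (hf : StrictAnti f) : (ofPos f hf).pos = f :=
  funext fun i => Nat.sub_add_cancel (sub_le_apply_of_strictAnti hf i)

variable {lam lam' : FixedPartition m}

/-- Whether a site is occupied by a particle of the partition. -/
def occ (lam : FixedPartition m) (p : ℕ) : Bool := decide (∃ i, lam.pos i = p)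

theorem occ_eq_true_iff {p : ℕ} : lam.occ p = true ↔ ∃ i, lam.pos i = p := decide_eq_true_iff

theorem occ_pos (lam : FixedPartition m) (i : Fin m) : lam.occ (lam.pos i) = true :=
  occ_eq_true_iff.2 ⟨i, rfl⟩

theorem count_occ (lam : FixedPartition m) (p : ℕ) :
    Nat.count (lam.occ · = true) p = Finset.card {i | lam.pos i < p} := by
  rw [Nat.count_eq_card_filter_range,
    ← Finset.card_image_of_injective _ lam.strictAnti_pos.injective]
  congr 1
  ext q
  simp only [Finset.mem_filter, Finset.mem_range, occ_eq_true_iff, Finset.mem_image,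
    Finset.mem_univ, true_and]
  constructor
  · rintro ⟨hq, i, rfl⟩
    exact ⟨i, hq, rfl⟩
  · rintro ⟨i, hi, rfl⟩
    exact ⟨hi, i, rfl⟩

theorem count_occ_pos (lam : FixedPartition m) (i : Fin m) :
    Nat.count (lam.occ · = true) (lam.pos i) = m - 1 - i := by
  rw [count_occ, ← Fin.card_Ioi]
  congr 1
  ext j
  simp [lam.strictAnti_pos.lt_iff_gt]

theorem pos_lt_iff {i : Fin m} {p : ℕ} :
    lam.pos i < p ↔ m - i ≤ Nat.count (lam.occ · = true) p := by
  rw [count_occ]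
  constructor
  · intro h
    rw [← Fin.card_Ici]
    exact Finset.card_le_card fun j hj => by
      simpa using (lam.strictAnti_pos.antitone (Finset.mem_Ici.1 hj)).trans_lt h
  · contrapose!
    intro h
    calc
      Finset.card {j | lam.pos j < p} ≤ (Finset.Ioi i).card :=
        Finset.card_le_card fun j hj =>
          Finset.mem_Ioi.2 <| lam.strictAnti_pos.lt_iff_gt.1 <|
            (Finset.mem_filter.1 hj).2.trans_le h
      _ < m - i := by
        rw [Fin.card_Ioi]
        omega

theorem occ_injective : Function.Injective (occ : FixedPartition m → ℕ → Bool) := by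
  intro lam lam' h
  have hpos (i : Fin m) : lam.pos i = lam'.pos i :=
    eq_of_forall_gt_iff fun p => by rw [pos_lt_iff, pos_lt_iff, h]
  exact parts_injective (funext fun i => by simpa [pos] using hpos i)

theorem exists_occ_eq {a : ℕ → Bool} {K : ℕ} (ha : ∀ p, a p = true → p < K)
    (hm : Nat.count (a · = true) K = m) : ∃ lam : FixedPartition m, lam.occ = a := by
  rw [Nat.count_eq_card_filter_range] at hm
  let f := Finset.orderEmbOfFin _ hm
  refine ⟨ofPos (f ∘ Fin.rev) (f.strictMono.comp_strictAnti Fin.rev_strictAnti), ?_⟩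
  funext p
  rw [Bool.eq_iff_iff, occ_eq_true_iff, pos_ofPos, ← Set.mem_range,
    Fin.rev_surjective.range_comp, Finset.range_orderEmbOfFin]
  simpa using ha p

theorem occ_eq_false_of_le {K : ℕ} (hK : ∀ i, lam.pos i < K) {p : ℕ} (hp : K ≤ p) :
    lam.occ p = false := by
  rw [occ, decide_eq_false_iff_not]
  rintro ⟨i, rfl⟩
  exact absurd (hK i) (not_lt.2 hp)

/-- The skew shape `lam / lam'` is a horizontal strip. -/
def Interlaces (lam' lam : FixedPartition m) : Prop :=
  (∀ i, lam'.parts i ≤ lam.parts i) ∧ ∀ i i', i < i' → lam.parts i' ≤ lam'.parts i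

theorem Interlaces.pos_le (h : Interlaces lam' lam) (i : Fin m) : lam'.pos i ≤ lam.pos i :=
  Nat.add_le_add_right (h.1 i) _

theorem Interlaces.pos_lt (h : Interlaces lam' lam) {i i' : Fin m} (hi : i < i') :
    lam.pos i' < lam'.pos i := by
  have hparts := h.2 i i' hi
  have : (i : ℕ) < i' := hi
  simp only [pos]
  omega

theorem Interlaces.pos_lt_of_pos_lt (h : Interlaces lam' lam) {K : ℕ} (hK : ∀ i, lam.pos i < K)
    (i : Fin m) : lam'.pos i < K :=
  (h.pos_le i).trans_lt (hK i)

theorem interlaces_of_pos (h₁ : ∀ i, lam'.pos i ≤ lam.pos i)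
    (h₂ : ∀ i i', i < i' → lam.pos i' < lam'.pos i) : Interlaces lam' lam := by
  refine ⟨fun i => Nat.le_of_add_le_add_right (h₁ i), fun i i' hi => ?_⟩
  have : (i : ℕ) < i' := hi
  let j : Fin m := ⟨i + 1, by omega⟩
  have hpos := h₂ i j (Nat.lt_succ_self i)
  have hanti : lam.parts i' ≤ lam.parts j := lam.antitone_parts (Nat.succ_le_of_lt this)
  simp only [pos, j] at hpos hanti
  omega

/-- Whether a particle moves from site `p - 1` to site `p` when the strip `lam / lam'` is added. -/
def edge (lam' lam : FixedPartition m) (p : ℕ) : Bool :=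
  decide (∃ i, lam'.pos i < p ∧ p ≤ lam.pos i)

theorem edge_eq_true_iff {p : ℕ} : edge lam' lam p = true ↔ ∃ i, lam'.pos i < p ∧ p ≤ lam.pos i :=
  decide_eq_true_iff

theorem edge_zero (lam' lam : FixedPartition m) : edge lam' lam 0 = false := by
  simp [edge]

theorem edge_eq_false {K : ℕ} (hK : ∀ i, lam.pos i < K) : edge lam' lam K = false := by
  simp [edge, hK]

theorem Interlaces.conserves (h : Interlaces lam' lam) (p : ℕ) :
    Conserves (edge lam' lam p) (lam'.occ p) (lam.occ p) (edge lam' lam (p + 1)) := by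
  simp only [conserves_iff, edge_eq_true_iff, occ_eq_true_iff]
  refine ⟨?_, ?_, ?_, ?_⟩
  · rintro ⟨⟨i, hi, hi'⟩, j, rfl⟩
    exact absurd (h.pos_lt (lam'.strictAnti_pos.lt_iff_gt.1 hi)) (not_lt.2 hi')
  · rintro ⟨⟨j, rfl⟩, i, hi, hi'⟩
    exact absurd (h.pos_lt (lam.strictAnti_pos.lt_iff_gt.1 hi')) (by omega)
  · rintro (⟨i, hi, hi'⟩ | ⟨i, rfl⟩)
    · exact hi'.eq_or_lt.imp (fun heq => ⟨i, heq.symm⟩) fun hlt => ⟨i, by omega, hlt⟩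
    · exact (h.pos_le i).eq_or_lt.imp (fun heq => ⟨i, heq.symm⟩) fun hlt => ⟨i, by omega, hlt⟩
  · rintro (⟨i, rfl⟩ | ⟨i, hi, hi'⟩)
    · exact (h.pos_le i).lt_or_eq.imp (fun hlt => ⟨i, hlt, le_rfl⟩) fun heq => ⟨i, heq⟩
    · exact (Nat.le_of_lt_succ hi).lt_or_eq.imp (fun hlt => ⟨i, hlt, by omega⟩)
        fun heq => ⟨i, heq⟩

theorem interlaces_of_conserves {K : ℕ} (hK : ∀ i, lam'.pos i < K) {e : ℕ → Bool}
    (h0 : e 0 = false) (he : ∀ p < K, Conserves (e p) (lam'.occ p) (lam.occ p) (e (p + 1))) :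
    Interlaces lam' lam := by
  have hcount (i : Fin m) : Nat.count (lam.occ · = true) (lam'.pos i) = m - 1 - i := by
    have h := count_eq_add_of_conserves h0 he (hK i).le
    rwa [count_occ_pos, (he _ (hK i)).left_eq_false (lam'.occ_pos i), Bool.toNat_false, add_zero,
      eq_comm] at h
  refine interlaces_of_pos (fun i => not_lt.1 ?_) fun i i' hi => ?_
  · rw [pos_lt_iff, hcount]
    omega
  · have : (i : ℕ) < i' := hi
    rw [pos_lt_iff, hcount]
    omega

theorem exists_interlaces_of_conserves {K : ℕ} (hK : ∀ i, lam.pos i < K) {a e : ℕ → Bool}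
    (ha : ∀ p, a p = true → p < K) (h0 : e 0 = false) (h1 : e K = false)
    (he : ∀ p < K, Conserves (e p) (a p) (lam.occ p) (e (p + 1))) :
    ∃ lam' : FixedPartition m, Interlaces lam' lam ∧ lam'.occ = a := by
  have hm : Nat.count (a · = true) K = m := by
    simpa [count_occ, h1, hK] using count_eq_add_of_conserves h0 he le_rfl
  obtain ⟨lam', rfl⟩ := exists_occ_eq ha hm
  exact ⟨lam', interlaces_of_conserves (fun i => ha _ (lam'.occ_pos i)) h0 he, rfl⟩

theorem finite_setOf_interlaces (lam : FixedPartition m) : {lam' | Interlaces lam' lam}.Finite :=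
  .of_finite_image ((Set.finite_Iic lam.parts).subset (by rintro _ ⟨lam', h, rfl⟩; exact h.1))
    parts_injective.injOn

/-- The finite set of partitions obtained by removing a horizontal strip. -/
noncomputable def stripped (lam : FixedPartition m) : Finset (FixedPartition m) :=
  lam.finite_setOf_interlaces.toFinset

theorem mem_stripped : lam' ∈ lam.stripped ↔ Interlaces lam' lam := by
  simp [stripped]

end FixedPartition

section RowOperator

open Matrix FixedPartition

theorem Conserves.right_unique {b s s' b' b'' : Bool} (h : Conserves b s s' b')
    (h' : Conserves b s s' b'') : b' = b'' := by
  revert b s s' b' b''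
  unfold Conserves
  decide

variable {A : Type*} [CommRing A] (x t : A) {K : ℕ}

theorem mpo_lax_apply (S S' : Fin K → Occ) (e : ℕ → Occ)
    (he : ∀ p : Fin K, Conserves (e p).1 (S p).1 (S' p).1 (e (p + 1)).1 ∧
      Conserves (e p).2 (S p).2 (S' p).2 (e (p + 1)).2) :
    mpo (lax x t) S S' (e 0) (e K) =
      ∏ p : Fin K, x ^ ((e (p + 1)).1.toNat + (e (p + 1)).2.toNat) *
        t ^ ((e (p + 1)).1 && ((e p).2 || (S p).2)).toNat := by
  induction K generalizing e with
  | zero => simp [mpo_zero]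
  | succ K ih =>
    cases S using Fin.consCases with | _ s S
    cases S' using Fin.consCases with | _ s' S'
    have h0 := he 0
    have htail := ih S S' (fun p => e (p + 1)) fun p => by simpa using he p.succ
    simp only [Fin.cons_zero, Fin.val_zero, zero_add] at h0 htail
    rw [mpo_cons, Matrix.mul_apply, Finset.sum_eq_single (e 1), htail, Fin.prod_univ_succ]
    · simp [lax, h0]
    · intro b _ hb
      rw [lax, Matrix.of_apply, if_neg, zero_mul]
      exact fun h => hb (Prod.ext (h.1.right_unique h0.1) (h.2.right_unique h0.2))
    · simp

theorem exists_edges_of_mpo_lax_ne_zero {S S' : Fin K → Occ} {b b' : Occ}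
    (h : mpo (lax x t) S S' b b' ≠ 0) :
    ∃ e : ℕ → Occ, e 0 = b ∧ e K = b' ∧
      ∀ p : Fin K, Conserves (e p).1 (S p).1 (S' p).1 (e (p + 1)).1 ∧
        Conserves (e p).2 (S p).2 (S' p).2 (e (p + 1)).2 := by
  induction K generalizing b with
  | zero =>
    refine ⟨fun _ => b, rfl, not_not.1 fun hb => h ?_, fun p => p.elim0⟩
    rw [mpo_zero, Matrix.one_apply_ne hb]
  | succ K ih =>
    cases S using Fin.consCases with | _ s S
    cases S' using Fin.consCases with | _ s' S'
    rw [mpo_cons, Matrix.mul_apply] at h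
    obtain ⟨c, -, hc⟩ := Finset.exists_ne_zero_of_sum_ne_zero h
    obtain ⟨e, rfl, hend, htail⟩ := ih (right_ne_zero_of_mul hc)
    have h0 := (ite_ne_right_iff.1 (left_ne_zero_of_mul hc)).1
    exact ⟨fun p => Nat.casesOn p b e, rfl, hend, Fin.cases h0 htail⟩

variable {m m' : ℕ}

/-- The boundary state given by a pair of partitions, one for each colour. -/
def pairState (K : ℕ) (lam : FixedPartition m) (mu : FixedPartition m') : Fin K → Occ :=
  fun p => (lam.occ p, mu.occ p)

/-- The weight of adding the horizontal strips `lam / lam'` and `mu / mu'`. -/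
def stripWeight (K : ℕ) (lam' lam : FixedPartition m) (mu' mu : FixedPartition m') : A :=
  ∏ p : Fin K, x ^ ((edge lam' lam (p + 1)).toNat + (edge mu' mu (p + 1)).toNat) *
    t ^ (edge lam' lam (p + 1) && (edge mu' mu p || mu'.occ p)).toNat

theorem pairState_injective {lam lam' : FixedPartition m} {mu mu' : FixedPartition m'}
    (hlam : ∀ i, lam.pos i < K) (hmu : ∀ i, mu.pos i < K) (hlam' : ∀ i, lam'.pos i < K)
    (hmu' : ∀ i, mu'.pos i < K) (h : pairState K lam mu = pairState K lam' mu') :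
    lam = lam' ∧ mu = mu' := by
  constructor <;> refine occ_injective (funext fun p => ?_) <;> rcases lt_or_ge p K with hp | hp
  · exact congrArg Prod.fst (congrFun h ⟨p, hp⟩)
  · rw [occ_eq_false_of_le hlam hp, occ_eq_false_of_le hlam' hp]
  · exact congrArg Prod.snd (congrFun h ⟨p, hp⟩)
  · rw [occ_eq_false_of_le hmu hp, occ_eq_false_of_le hmu' hp]

variable {lam : FixedPartition m} {mu : FixedPartition m'}

theorem rowOp_pairState (hlam : ∀ i, lam.pos i < K) (hmu : ∀ i, mu.pos i < K)
    {lam' : FixedPartition m} {mu' : FixedPartition m'} (hl : Interlaces lam' lam)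
    (hm : Interlaces mu' mu) :
    rowOp x t K (pairState K lam' mu') (pairState K lam mu) =
      stripWeight x t K lam' lam mu' mu := by
  have h := mpo_lax_apply x t (pairState K lam' mu') (pairState K lam mu)
    (fun p => (edge lam' lam p, edge mu' mu p)) fun p => ⟨hl.conserves p, hm.conserves p⟩
  simp only [edge_zero, edge_eq_false hlam, edge_eq_false hmu] at h
  exact h

theorem exists_pairState_eq_of_rowOp_ne_zero (hlam : ∀ i, lam.pos i < K)
    (hmu : ∀ i, mu.pos i < K) {S : Fin K → Occ} (h : rowOp x t K S (pairState K lam mu) ≠ 0) :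
    ∃ lam' ∈ lam.stripped, ∃ mu' ∈ mu.stripped, pairState K lam' mu' = S := by
  obtain ⟨e, h0, h1, he⟩ := exists_edges_of_mpo_lax_ne_zero x t h
  let a : ℕ → Occ := fun p => if h : p < K then S ⟨p, h⟩ else Occ.empty
  have ha (p : Fin K) : a p = S p := dif_pos p.2
  have ha' (p : ℕ) (hp : a p ≠ Occ.empty) : p < K := by_contra fun h => hp (dif_neg h)
  obtain ⟨lam', hl, hl'⟩ := exists_interlaces_of_conserves hlam (a := fun p => (a p).1)
    (e := fun p => (e p).1) (fun p hp => ha' p fun h => by simp [h] at hp) (by rw [h0])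
    (by rw [h1]) fun p hp => by simpa only [ha ⟨p, hp⟩, pairState] using (he ⟨p, hp⟩).1
  obtain ⟨mu', hm, hm'⟩ := exists_interlaces_of_conserves hmu (a := fun p => (a p).2)
    (e := fun p => (e p).2) (fun p hp => ha' p fun h => by simp [h] at hp) (by rw [h0])
    (by rw [h1]) fun p hp => by simpa only [ha ⟨p, hp⟩, pairState] using (he ⟨p, hp⟩).2
  refine ⟨lam', mem_stripped.2 hl, mu', mem_stripped.2 hm, funext fun p => ?_⟩
  simp only [pairState, hl', hm', ha]

theorem vecMul_rowOp_pairState (hlam : ∀ i, lam.pos i < K) (hmu : ∀ i, mu.pos i < K)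
    (ψ : (Fin K → Occ) → A) :
    (ψ ᵥ* rowOp x t K) (pairState K lam mu) = ∑ lam' ∈ lam.stripped, ∑ mu' ∈ mu.stripped,
      ψ (pairState K lam' mu') * stripWeight x t K lam' lam mu' mu := by
  rw [← Finset.sum_product', Matrix.vecMul, dotProduct]
  refine (Finset.sum_of_injOn (fun q => pairState K q.1 q.2) ?_ ?_ ?_ ?_).symm
  · rintro ⟨l, u⟩ h ⟨l', u'⟩ h' heq
    simp only [Finset.coe_product, Set.mem_prod, Finset.mem_coe, mem_stripped] at h h'
    exact Prod.ext_iff.2 <| pairState_injective (h.1.pos_lt_of_pos_lt hlam)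
      (h.2.pos_lt_of_pos_lt hmu) (h'.1.pos_lt_of_pos_lt hlam) (h'.2.pos_lt_of_pos_lt hmu) heq
  · exact fun _ _ => Finset.mem_coe.2 (Finset.mem_univ _)
  · intro S _ hS
    refine not_not.1 fun hne => hS ?_
    obtain ⟨l, hl, u, hu, rfl⟩ :=
      exists_pairState_eq_of_rowOp_ne_zero x t hlam hmu (right_ne_zero_of_mul hne)
    exact ⟨(l, u), Finset.mem_coe.2 (Finset.mk_mem_product hl hu), rfl⟩
  · intro q hq
    rw [Finset.mem_product, mem_stripped, mem_stripped] at hq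
    rw [rowOp_pairState x t hlam hmu hq.1 hq.2]

theorem partitionFun_succ {N : ℕ} (x : Fin (N + 1) → A) :
    partitionFun t x (K := K) =
      partitionFun t (x ∘ Fin.castSucc) * rowOp (x (Fin.last N)) t K := by
  simp only [partitionFun, List.ofFn_succ', List.concat_eq_append, List.prod_append,
    List.prod_singleton, Function.comp_apply]

end RowOperator

section Tableaux

theorem exists_forall_iff_val_lt {k : ℕ} (p : Fin k → Prop) (hp : ∀ i j, i ≤ j → p j → p i) :
    ∃ c ≤ k, ∀ j : Fin k, p j ↔ (j : ℕ) < c := by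
  classical
  by_cases h : ∃ j : ℕ, ∃ hj : j < k, ¬p ⟨j, hj⟩
  · obtain ⟨hk, hn⟩ := Nat.find_spec h
    exact ⟨Nat.find h, hk.le, fun j => ⟨fun hj => not_le.1 fun hle => hn (hp _ j hle hj),
      fun hj => not_not.1 fun hpj => Nat.find_min h hj ⟨j.2, hpj⟩⟩⟩
  · push Not at h
    exact ⟨k, le_rfl, fun j => ⟨fun _ => j.2, fun _ => h j j.2⟩⟩

namespace FixedPartition

variable {m N : ℕ} {lam' lam : FixedPartition m}

theorem mem_ssyt {T : lam.Cell → Fin N} : T ∈ lam.ssyt N ↔ lam.IsSemistandard T := by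
  simp only [ssyt, Finset.mem_filter_univ]

/-- Extend a filling of `lam'` to `lam` by the largest letter. -/
def extend (lam' lam : FixedPartition m) (T : lam'.Cell → Fin N) : lam.Cell → Fin (N + 1) :=
  fun c => if h : (c.2 : ℕ) < lam'.parts c.1 then (T ⟨c.1, ⟨c.2, h⟩⟩).castSucc else Fin.last N

theorem extend_eq_last_iff {T : lam'.Cell → Fin N} {c : lam.Cell} :
    extend lam' lam T c = Fin.last N ↔ lam'.parts c.1 ≤ c.2 := by
  rw [extend]
  split_ifs with h
  · simp only [Fin.castSucc_ne_last, false_iff, not_le, h]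
  · simpa only [true_iff, not_lt] using h

theorem Interlaces.isSemistandard_extend (h : Interlaces lam' lam) {T : lam'.Cell → Fin N}
    (hT : lam'.IsSemistandard T) : lam.IsSemistandard (extend lam' lam T) := by
  constructor
  · intro i j j' hj
    by_cases hj' : (j' : ℕ) < lam'.parts i
    · have hj0 : (j : ℕ) < lam'.parts i := lt_of_le_of_lt hj hj'
      simp only [extend, hj', hj0, dif_pos]
      exact Fin.castSucc_le_castSucc_iff.2 (hT.1 i ⟨j, hj0⟩ ⟨j', hj'⟩ hj)
    · rw [(extend_eq_last_iff (c := ⟨i, j'⟩)).2 (not_lt.1 hj')]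
      exact Fin.le_last _
  · intro i i' j hj hj' hi
    have hji : j < lam'.parts i := hj'.trans_le (h.2 i i' hi)
    by_cases hji' : j < lam'.parts i'
    · simp only [extend, hji, hji', dif_pos]
      exact Fin.castSucc_lt_castSucc_iff.2 (hT.2 i i' j hji hji' hi)
    · simp only [extend, hji, hji', dif_pos, dif_neg, not_false_eq_true]
      exact Fin.castSucc_lt_last _

theorem Interlaces.parts_le_of_extend_eq {lam₁ lam₂ : FixedPartition m}
    {T₁ : lam₁.Cell → Fin N} {T₂ : lam₂.Cell → Fin N} (h₂ : Interlaces lam₂ lam)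
    (h : extend lam₁ lam T₁ = extend lam₂ lam T₂) (i : Fin m) : lam₂.parts i ≤ lam₁.parts i := by
  by_contra! hlt
  have hcell := congrFun h ⟨i, ⟨lam₁.parts i, hlt.trans_le (h₂.1 i)⟩⟩
  rw [extend_eq_last_iff.2 le_rfl, eq_comm, extend_eq_last_iff] at hcell
  exact hlt.not_ge hcell

theorem extend_injective {lam₁ lam₂ : FixedPartition m} (h₁ : Interlaces lam₁ lam)
    (h₂ : Interlaces lam₂ lam) {T₁ : lam₁.Cell → Fin N} {T₂ : lam₂.Cell → Fin N}
    (h : extend lam₁ lam T₁ = extend lam₂ lam T₂) :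
    (⟨lam₁, T₁⟩ : Σ l : FixedPartition m, l.Cell → Fin N) = ⟨lam₂, T₂⟩ := by
  obtain rfl : lam₁ = lam₂ := parts_injective <| funext fun i =>
    le_antisymm (h₁.parts_le_of_extend_eq h.symm i) (h₂.parts_le_of_extend_eq h i)
  obtain rfl : T₁ = T₂ := funext fun ⟨i, j⟩ => by
    simpa [extend] using congrFun h ⟨i, ⟨j, j.2.trans_le (h₁.1 i)⟩⟩
  rfl

theorem exists_extend_eq {T : lam.Cell → Fin (N + 1)} (hT : lam.IsSemistandard T) :
    ∃ lam', Interlaces lam' lam ∧ ∃ T' : lam'.Cell → Fin N, lam'.IsSemistandard T' ∧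
      extend lam' lam T' = T := by
  choose c hc hc' using fun i => exists_forall_iff_val_lt (fun j => T ⟨i, j⟩ ≠ Fin.last N)
    fun j j' hj h => ((hT.1 i j j' hj).trans_lt (lt_of_le_of_ne (Fin.le_last _) h)).ne
  have hcol (i i' : Fin m) (hi : i < i') : lam.parts i' ≤ c i := by
    by_contra! hlt
    have hci : c i < lam.parts i := hlt.trans_le (lam.antitone_parts hi.le)
    exact lt_irrefl _ <| (hc' i ⟨c i, hci⟩).1
      ((hT.2 i i' (c i) hci hlt hi).trans_le (Fin.le_last _)).ne
  let lam' : FixedPartition m := ⟨c, fun i i' hi => by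
    rcases hi.eq_or_lt with rfl | hi
    exacts [le_rfl, (hc i').trans (hcol i i' hi)]⟩
  have hne (v : lam'.Cell) : T ⟨v.1, ⟨v.2, v.2.2.trans_le (hc v.1)⟩⟩ ≠ Fin.last N :=
    (hc' v.1 ⟨v.2, v.2.2.trans_le (hc v.1)⟩).2 v.2.2
  refine ⟨lam', ⟨hc, hcol⟩, fun v => (T ⟨v.1, ⟨v.2, v.2.2.trans_le (hc v.1)⟩⟩).castPred (hne v),
    ⟨fun i j j' hj => ?_, fun i i' j hj hj' hi => ?_⟩, funext fun v => ?_⟩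
  · exact Fin.castPred_le_castPred_iff.2 (hT.1 i _ _ hj)
  · exact Fin.castPred_lt_castPred_iff.2 (hT.2 i i' j _ _ hi)
  · by_cases hv : (v.2 : ℕ) < lam'.parts v.1
    · simp [extend, hv]
    · rw [extend_eq_last_iff.2 (not_lt.1 hv)]
      exact (not_not.1 fun hlast => hv ((hc' v.1 v.2).1 hlast)).symm

theorem sum_ssyt_succ {M : Type*} [AddCommMonoid M] (lam : FixedPartition m)
    (F : (lam.Cell → Fin (N + 1)) → M) :
    ∑ T ∈ lam.ssyt (N + 1), F T =
      ∑ lam' ∈ lam.stripped, ∑ T ∈ lam'.ssyt N, F (extend lam' lam T) := by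
  rw [Finset.sum_sigma']
  refine (Finset.sum_bij (fun q _ => extend q.1 lam q.2) ?_ ?_ ?_ fun _ _ => rfl).symm
  · rintro ⟨l, T⟩ hq
    rw [Finset.mem_sigma, mem_stripped, mem_ssyt] at hq
    exact mem_ssyt.2 (hq.1.isSemistandard_extend hq.2)
  · rintro ⟨l, T⟩ hq ⟨l', T'⟩ hq' h
    rw [Finset.mem_sigma, mem_stripped] at hq hq'
    exact extend_injective hq.1 hq'.1 h
  · intro T hT
    obtain ⟨l, hl, T', hss, rfl⟩ := exists_extend_eq (mem_ssyt.1 hT)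
    exact ⟨⟨l, T'⟩, Finset.mem_sigma.2 ⟨mem_stripped.2 hl, mem_ssyt.2 hss⟩, rfl⟩

/-- The inclusion of the diagram of `lam'` into that of `lam`. -/
def Interlaces.cellEmb (h : Interlaces lam' lam) : lam'.Cell ↪ lam.Cell :=
  .sigmaMap (.refl _) fun i => Fin.castLEEmb (h.1 i)

theorem Interlaces.extend_cellEmb (h : Interlaces lam' lam) (T : lam'.Cell → Fin N)
    (v : lam'.Cell) : extend lam' lam T (h.cellEmb v) = (T v).castSucc :=
  dif_pos v.2.2

theorem Interlaces.prod_cell {M : Type*} [CommMonoid M] (h : Interlaces lam' lam)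
    (f : lam.Cell → M) :
    ∏ v, f v = (∏ v, f (h.cellEmb v)) * ∏ v with lam'.parts v.1 ≤ v.2, f v := by
  rw [← Finset.prod_filter_mul_prod_filter_not Finset.univ fun v : lam.Cell =>
    (v.2 : ℕ) < lam'.parts v.1, ← Finset.prod_map Finset.univ h.cellEmb]
  simp only [not_lt]
  congr 2 with v
  simp only [Finset.mem_filter_univ, Finset.mem_map, Finset.mem_univ, true_and]
  exact ⟨fun hv => ⟨⟨v.1, ⟨v.2, hv⟩⟩, rfl⟩, by rintro ⟨w, rfl⟩; exact w.2.2⟩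

theorem Interlaces.injOn_strip_content (h : Interlaces lam' lam) :
    Set.InjOn (fun v : lam.Cell => (v.2 : ℕ) + (m - 1 - v.1)) {v | lam'.parts v.1 ≤ v.2} := by
  have hnot {v w : lam.Cell} (hv : lam'.parts v.1 ≤ v.2)
      (hvw : (v.2 : ℕ) + (m - 1 - v.1) = w.2 + (m - 1 - w.1)) : ¬v.1 < w.1 :=
    fun hlt => (Nat.add_lt_add_right w.2.2 _).not_ge <|
      (h.pos_lt hlt).le.trans <| (Nat.add_le_add_right hv _).trans hvw.le
  rintro ⟨i, j⟩ hv ⟨i', j'⟩ hw hvw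
  obtain rfl : i = i' := le_antisymm (not_lt.1 (hnot hw hvw.symm)) (not_lt.1 (hnot hv hvw))
  obtain rfl : j = j' := Fin.ext (Nat.add_right_cancel hvw)
  rfl

theorem Interlaces.sum_edge (h : Interlaces lam' lam) {K : ℕ} (hK : ∀ i, lam.pos i < K)
    (G : ℕ → ℕ) :
    ∑ p : Fin K, (if edge lam' lam (p + 1) = true then G p else 0) =
      ∑ v : lam.Cell with lam'.parts v.1 ≤ v.2, G (v.2 + (m - 1 - v.1)) := by
  have hlt (v : lam.Cell) : (v.2 : ℕ) + (m - 1 - v.1) < lam.pos v.1 :=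
    Nat.add_lt_add_right v.2.2 _
  rw [← Finset.sum_filter]
  refine (Finset.sum_bij (fun v _ => ⟨v.2 + (m - 1 - v.1), (hlt v).trans (hK v.1)⟩) ?_ ?_ ?_
    fun _ _ => rfl).symm
  · intro v hv
    rw [Finset.mem_filter_univ] at hv ⊢
    exact edge_eq_true_iff.2 ⟨v.1, Nat.lt_succ_of_le (Nat.add_le_add_right hv _), hlt v⟩
  · intro v hv w hw hvw
    rw [Finset.mem_filter_univ] at hv hw
    exact h.injOn_strip_content hv hw (Fin.mk.inj hvw)
  · intro p hp
    rw [Finset.mem_filter_univ, edge_eq_true_iff] at hp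
    obtain ⟨i, hle, hlt⟩ := hp
    simp only [pos] at hle hlt
    exact ⟨⟨i, ⟨p - (m - 1 - i), by omega⟩⟩, (Finset.mem_filter_univ _).2 (by lia),
      Fin.ext (by lia)⟩

end FixedPartition

end Tableaux

section Coinversions

open FixedPartition

variable {m m' N : ℕ}

/-- Column `c` is a position of row `r`, possibly the one directly to the right of its end, whose
entry and left neighbour enclose `b`; missing neighbours impose no condition. -/
def Encloses {mu : FixedPartition m'} (U : mu.Cell → Fin N) (r : Fin m') (c : ℕ) (b : Fin N) :
    Prop :=
  c ≤ mu.parts r ∧ (∀ (c' : ℕ) (hc : c' < mu.parts r), c = c' + 1 → U ⟨r, ⟨c', hc⟩⟩ ≤ b) ∧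
    ∀ hc : c < mu.parts r, b ≤ U ⟨r, ⟨c, hc⟩⟩

open Classical in
theorem coinv_eq_sum {lam : FixedPartition m} {mu : FixedPartition m'} (T : lam.Cell → Fin N)
    (U : mu.Cell → Fin N) :
    coinv T U = ∑ v : lam.Cell, Finset.card {r : Fin m' |
      ∃ c : ℕ, c + v.1 = v.2 + r ∧ Encloses U r c (T v)} := by
  let P : lam.Cell × Fin m' → Prop := fun q =>
    ∃ c : ℕ, c + q.1.1 = q.1.2 + q.2 ∧ Encloses U q.2 c (T q.1)
  let f : {τ : LLTTriple lam mu // τ.IsCoinversion T U} → {q // P q} := fun τ =>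
    ⟨(τ.1.v, τ.1.row), τ.1.col, by have := τ.1.content_eq; simp only; omega,
      Nat.lt_succ_iff.1 τ.1.col.2, τ.2.1, τ.2.2⟩
  have hf : Function.Bijective f := by
    constructor
    · rintro ⟨⟨v, r, c, hc⟩, hτ⟩ ⟨⟨v', r', c', hc'⟩, hτ'⟩ h
      simp only [f, Subtype.mk.injEq, Prod.mk.injEq] at h
      obtain ⟨rfl, rfl⟩ := h
      obtain rfl : c = c' := Fin.ext (by omega)
      rfl
    · rintro ⟨⟨v, r⟩, c, hc, hle, hleft, hright⟩
      exact ⟨⟨⟨v, r, ⟨c, Nat.lt_succ_iff.2 hle⟩, by simp only at hc ⊢; omega⟩, hleft, hright⟩, rfl⟩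
  rw [coinv, Nat.card_congr (Equiv.ofBijective f hf), Nat.card_eq_fintype_card,
    Fintype.card_subtype, Finset.card_filter, Fintype.sum_prod_type]
  simp only [Finset.card_filter, P]

variable {mu' mu : FixedPartition m}

theorem encloses_extend_castSucc (h : Interlaces mu' mu) (U : mu'.Cell → Fin N) (r : Fin m)
    (c : ℕ) (b : Fin N) : Encloses (extend mu' mu U) r c b.castSucc ↔ Encloses U r c b := by
  have extend_apply (c : ℕ) (hc : c < mu.parts r) (hc' : c < mu'.parts r) :
      extend mu' mu U ⟨r, ⟨c, hc⟩⟩ = (U ⟨r, ⟨c, hc'⟩⟩).castSucc := dif_pos hc'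
  constructor
  · rintro ⟨hle, hleft, hright⟩
    refine ⟨?_, fun c' hc' hcc => ?_, fun hc => ?_⟩
    · rcases c with _ | c
      · exact Nat.zero_le _
      · refine not_lt.1 fun hlt => (Fin.castSucc_lt_last b).not_ge ?_
        exact (extend_eq_last_iff.2 (Nat.le_of_lt_succ hlt)).ge.trans (hleft c hle rfl)
    · simpa only [extend_apply _ _ hc', Fin.castSucc_le_castSucc_iff] using
        hleft c' (hc'.trans_le (h.1 r)) hcc
    · simpa only [extend_apply _ _ hc, Fin.castSucc_le_castSucc_iff] using
        hright (hc.trans_le (h.1 r))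
  · rintro ⟨hle, hleft, hright⟩
    refine ⟨hle.trans (h.1 r), fun c' hc' hcc => ?_, fun hc => ?_⟩
    · have hlt : c' < mu'.parts r := hcc.symm.trans_le hle
      rw [extend_apply _ _ hlt, Fin.castSucc_le_castSucc_iff]
      exact hleft c' hlt hcc
    · by_cases hlt : c < mu'.parts r
      · rw [extend_apply _ _ hlt, Fin.castSucc_le_castSucc_iff]
        exact hright hlt
      · rw [extend_eq_last_iff.2 (not_lt.1 hlt)]
        exact Fin.le_last _

theorem encloses_extend_last (h : Interlaces mu' mu) (U : mu'.Cell → Fin N) (r : Fin m) (c : ℕ) :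
    Encloses (extend mu' mu U) r c (Fin.last N) ↔ mu'.parts r ≤ c ∧ c ≤ mu.parts r := by
  constructor
  · rintro ⟨hle, -, hright⟩
    refine ⟨?_, hle⟩
    rcases hle.eq_or_lt with rfl | hlt
    exacts [h.1 r, extend_eq_last_iff.1 (le_antisymm (Fin.le_last _) (hright hlt))]
  · rintro ⟨hge, hle⟩
    exact ⟨hle, fun _ _ _ => Fin.le_last _, fun _ => (extend_eq_last_iff.2 hge).ge⟩

namespace FixedPartition

theorem Interlaces.edge_or_occ_eq_true_iff (h : Interlaces mu' mu) (p : ℕ) :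
    (edge mu' mu p || mu'.occ p) = true ↔ ∃ r, mu'.pos r ≤ p ∧ p ≤ mu.pos r := by
  rw [Bool.or_eq_true, edge_eq_true_iff, occ_eq_true_iff]
  constructor
  · rintro (⟨r, hlt, hle⟩ | ⟨r, rfl⟩)
    exacts [⟨r, hlt.le, hle⟩, ⟨r, le_rfl, h.pos_le r⟩]
  · rintro ⟨r, hle, hle'⟩
    exact hle.lt_or_eq.imp (⟨r, ·, hle'⟩) (⟨r, ·⟩)

theorem Interlaces.card_pos_le_le_pos (h : Interlaces mu' mu) (p : ℕ) :
    Finset.card {r | mu'.pos r ≤ p ∧ p ≤ mu.pos r} = (edge mu' mu p || mu'.occ p).toNat := by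
  by_cases hex : ∃ r, mu'.pos r ≤ p ∧ p ≤ mu.pos r
  · have hunique : ∃! r, mu'.pos r ≤ p ∧ p ≤ mu.pos r := by
      refine existsUnique_of_exists_of_unique hex fun r r' hr hr' => le_antisymm ?_ ?_
      exacts [not_lt.1 fun hlt => (h.pos_lt hlt).not_ge (hr'.1.trans hr.2),
        not_lt.1 fun hlt => (h.pos_lt hlt).not_ge (hr.1.trans hr'.2)]
    rw [(h.edge_or_occ_eq_true_iff p).2 hex, Bool.toNat_true]
    exact Fintype.existsUnique_iff_card_one _ |>.1 hunique
  · rw [Bool.eq_false_iff.2 (mt (h.edge_or_occ_eq_true_iff p).1 hex), Bool.toNat_false,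
      Finset.card_eq_zero, Finset.filter_eq_empty_iff]
    exact fun r _ hr => hex ⟨r, hr⟩

theorem Interlaces.sum_cell {lam' lam : FixedPartition m} (h : Interlaces lam' lam)
    (f : lam.Cell → ℕ) :
    ∑ v, f v = (∑ v, f (h.cellEmb v)) + ∑ v with lam'.parts v.1 ≤ v.2, f v :=
  h.prod_cell (M := Multiplicative ℕ) f

end FixedPartition

theorem exists_content_eq_and_iff (i r : Fin m) (j : ℕ) :
    (∃ c : ℕ, c + i = j + r ∧ mu'.parts r ≤ c ∧ c ≤ mu.parts r) ↔
      mu'.pos r ≤ j + (m - 1 - i) ∧ j + (m - 1 - i) ≤ mu.pos r := by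
  have := r.2
  have := i.2
  simp only [pos]
  constructor
  · rintro ⟨c, hc, hle, hle'⟩
    omega
  · rintro ⟨hle, hle'⟩
    exact ⟨j + (m - 1 - i) - (m - 1 - r), by omega, by omega, by omega⟩

variable {lam' lam : FixedPartition m} {K : ℕ}

theorem coinv_extend (hl : Interlaces lam' lam) (hm : Interlaces mu' mu) (T : lam'.Cell → Fin N)
    (U : mu'.Cell → Fin N) (hK : ∀ i, lam.pos i < K) :
    coinv (extend lam' lam T) (extend mu' mu U) = coinv T U +
      ∑ p : Fin K, (edge lam' lam (p + 1) && (edge mu' mu p || mu'.occ p)).toNat := by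
  classical
  have hand (a b : Bool) : (a && b).toNat = if a = true then b.toNat else 0 := by
    cases a <;> rfl
  simp only [hand]
  rw [hl.sum_edge hK fun p => (edge mu' mu p || mu'.occ p).toNat, coinv_eq_sum, coinv_eq_sum,
    hl.sum_cell]
  congr 1
  · refine Finset.sum_congr rfl fun v _ => ?_
    simp only [hl.extend_cellEmb, encloses_extend_castSucc hm]
    rfl
  · refine Finset.sum_congr rfl fun v hv => ?_
    have hlast : extend lam' lam T v = Fin.last N :=
      extend_eq_last_iff.2 ((Finset.mem_filter_univ v).1 hv)
    simp only [hlast, encloses_extend_last hm, exists_content_eq_and_iff]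
    exact hm.card_pos_le_le_pos _

theorem prod_X_extend {A : Type*} [CommSemiring A] (h : Interlaces lam' lam)
    (T : lam'.Cell → Fin N) (hK : ∀ i, lam.pos i < K) :
    ∏ v, (MvPolynomial.X (extend lam' lam T v) : MvPolynomial (Fin (N + 1)) A) =
      MvPolynomial.rename Fin.castSucc (∏ v, MvPolynomial.X (T v)) *
        MvPolynomial.X (Fin.last N) ^ ∑ p : Fin K, (edge lam' lam (p + 1)).toNat := by
  simp only [Bool.toNat, Bool.cond_eq_ite]
  rw [h.sum_edge hK fun _ => 1, h.prod_cell, map_prod, Finset.sum_const, smul_eq_mul, mul_one]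
  congr 1
  · refine Finset.prod_congr rfl fun v _ => ?_
    rw [h.extend_cellEmb, MvPolynomial.rename_X]
  · refine Finset.prod_eq_pow_card fun v hv => ?_
    rw [extend_eq_last_iff.2 ((Finset.mem_filter_univ v).1 hv)]

theorem LLT_succ (N : ℕ) (hlam : ∀ i, lam.pos i < K) (hmu : ∀ i, mu.pos i < K) :
    LLT (N + 1) lam mu = ∑ lam' ∈ lam.stripped, ∑ mu' ∈ mu.stripped,
      MvPolynomial.rename Fin.castSucc (LLT N lam' mu') *
        stripWeight (MvPolynomial.X (Fin.last N)) (MvPolynomial.C Polynomial.X) K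
          lam' lam mu' mu := by
  rw [LLT, sum_ssyt_succ]
  refine Finset.sum_congr rfl fun lam' hl => ?_
  simp only [sum_ssyt_succ mu]
  rw [Finset.sum_comm]
  refine Finset.sum_congr rfl fun mu' hm => ?_
  rw [mem_stripped] at hl hm
  simp only [LLT, map_sum, Finset.sum_mul]
  refine Finset.sum_congr rfl fun T _ => Finset.sum_congr rfl fun U _ => ?_
  rw [coinv_extend hl hm T U hlam, prod_X_extend hl T hlam, prod_X_extend hm U hmu, stripWeight,
    Finset.prod_mul_distrib, Finset.prod_pow_eq_pow_sum, Finset.prod_pow_eq_pow_sum,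
    Finset.sum_add_distrib]
  simp only [map_mul, MvPolynomial.rename_C, map_pow, pow_add]
  ring

end Coinversions

section PartitionFunction

open FixedPartition

variable {A B : Type*} [CommRing A] [CommRing B] (φ : A →+* B)

theorem map_lax (x t : A) (s s' b b' : Occ) :
    φ (lax x t s s' b b') = lax (φ x) (φ t) s s' b b' := by
  simp only [lax, Matrix.of_apply]
  split_ifs <;> simp

theorem mapMatrix_rowOp (x t : A) (K : ℕ) :
    φ.mapMatrix (rowOp x t K) = rowOp (φ x) (φ t) K := by
  ext S S'
  have h : (φ.mapMatrix ∘ fun p => lax x t (S p) (S' p)) = fun p => lax (φ x) (φ t) (S p) (S' p) :=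
    funext fun p => Matrix.ext fun b b' => map_lax φ x t _ _ b b'
  change φ.mapMatrix (mpo (lax x t) S S') Occ.empty Occ.empty =
    mpo (lax (φ x) (φ t)) S S' Occ.empty Occ.empty
  rw [mpo, map_list_prod, List.map_ofFn, mpo, h]

theorem map_partitionFun (t : A) {N : ℕ} (x : Fin N → A) {K : ℕ} (S S' : Fin K → Occ) :
    φ (partitionFun t x S S') = partitionFun (φ t) (φ ∘ x) S S' := by
  have h : (φ.mapMatrix ∘ fun i => rowOp (x i) t K) = fun i => rowOp ((φ ∘ x) i) (φ t) K :=
    funext fun i => mapMatrix_rowOp φ _ _ _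
  change φ.mapMatrix (partitionFun t x) S S' = _
  rw [partitionFun, map_list_prod, List.map_ofFn, partitionFun, h]

theorem rename_partitionFun {N N' K : ℕ} (f : Fin N → Fin N') (S S' : Fin K → Occ) :
    MvPolynomial.rename f
        (partitionFun (MvPolynomial.C (Polynomial.X : ℤ[X])) MvPolynomial.X S S') =
      partitionFun (MvPolynomial.C Polynomial.X) (MvPolynomial.X ∘ f) S S' := by
  refine (map_partitionFun (MvPolynomial.rename (R := ℤ[X]) f).toRingHom _ _ _ _).trans ?_
  congr 1
  exacts [MvPolynomial.rename_C _ _, funext fun i => MvPolynomial.rename_X _ _]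

variable {m : ℕ}

namespace FixedPartition

instance : Zero (FixedPartition m) := ⟨⟨0, antitone_const⟩⟩

theorem zero_pos_lt {lam : FixedPartition m} {K : ℕ} (h : ∀ i, lam.pos i < K) (i : Fin m) :
    (0 : FixedPartition m).pos i < K :=
  (Nat.add_le_add_right (Nat.zero_le (lam.parts i)) _).trans_lt (h i)

theorem ssyt_zero_eq_empty {lam : FixedPartition m} (h : lam ≠ 0) : lam.ssyt 0 = ∅ := by
  refine Finset.eq_empty_of_forall_notMem fun T _ => h (parts_injective (funext fun i => ?_))
  exact Nat.eq_zero_of_not_pos fun hi => (T ⟨i, ⟨0, hi⟩⟩).elim0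

instance : IsEmpty (0 : FixedPartition m).Cell := ⟨fun c => c.2.elim0⟩

theorem ssyt_zero_zero : (0 : FixedPartition m).ssyt 0 = {isEmptyElim} :=
  Finset.eq_singleton_iff_unique_mem.2 ⟨mem_ssyt.2
    ⟨fun _ j => j.elim0, fun _ _ _ hj => absurd hj (Nat.not_lt_zero _)⟩,
    fun _ _ => Subsingleton.elim _ _⟩

end FixedPartition

open Classical in
theorem LLT_zero (lam mu : FixedPartition m) :
    LLT 0 lam mu = if lam = 0 ∧ mu = 0 then 1 else 0 := by
  split_ifs with h
  · obtain ⟨rfl, rfl⟩ := h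
    rw [LLT, ssyt_zero_zero, Finset.sum_singleton, Finset.sum_singleton, coinv_eq_sum]
    simp only [Finset.univ_eq_empty, Finset.sum_empty, Finset.prod_empty, pow_zero, map_one,
      mul_one]
  · rcases not_and_or.1 h with h | h <;>
      simp only [LLT, ssyt_zero_eq_empty h, Finset.sum_empty, Finset.sum_const_zero]

theorem LLT_eq_partitionFun (N : ℕ) {lam mu : FixedPartition m} {K : ℕ}
    (hlam : ∀ i, lam.pos i < K) (hmu : ∀ i, mu.pos i < K) :
    LLT N lam mu = partitionFun (MvPolynomial.C Polynomial.X) MvPolynomial.X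
      (pairState K (0 : FixedPartition m) (0 : FixedPartition m)) (pairState K lam mu) := by
  classical
  induction N generalizing lam mu with
  | zero =>
    rw [LLT_zero, partitionFun, List.ofFn_zero, List.prod_nil, Matrix.one_apply]
    refine if_congr ⟨?_, fun h => ?_⟩ rfl rfl
    · rintro ⟨rfl, rfl⟩
      rfl
    · exact (pairState_injective (zero_pos_lt hlam) (zero_pos_lt hmu) hlam hmu h).imp .symm .symm
  | succ N ih =>
    rw [partitionFun_succ, Matrix.mul_apply_eq_vecMul,
      vecMul_rowOp_pairState _ _ hlam hmu,
      LLT_succ N hlam hmu]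
    refine Finset.sum_congr rfl fun lam' hl => Finset.sum_congr rfl fun mu' hm => ?_
    rw [mem_stripped] at hl hm
    rw [ih (hl.pos_lt_of_pos_lt hlam) (hm.pos_lt_of_pos_lt hmu), rename_partitionFun]

theorem FixedPartition.exists_pos_lt (lam : FixedPartition m) : ∃ K, ∀ i, lam.pos i < K :=
  ⟨Finset.univ.sup lam.pos + 1, fun i => Nat.lt_succ_of_le (Finset.le_sup (Finset.mem_univ i))⟩

theorem LLT_isSymmetric (N : ℕ) (lam mu : FixedPartition m) : (LLT N lam mu).IsSymmetric := by
  intro e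
  obtain ⟨K₁, h₁⟩ := lam.exists_pos_lt
  obtain ⟨K₂, h₂⟩ := mu.exists_pos_lt
  rw [LLT_eq_partitionFun N (fun i => (h₁ i).trans_le (le_max_left K₁ K₂))
    (fun i => (h₂ i).trans_le (le_max_right K₁ K₂)), rename_partitionFun,
    partitionFun_comp_perm MvPolynomial.X_ne_zero]
  rw [Ne, MvPolynomial.C_eq_zero]
  exact Polynomial.X_ne_zero

end PartitionFunction

section Words

variable {n : ℕ} {β : Fin (2 * n) → ℕ}

open FixedPartition

theorem famPart_pos (hβ : StrictAnti β) (S : HalfSubset n) (k : Fin n) :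
    (famPart β hβ S).pos k = β (S.1.orderEmbOfFin S.2 k) := by
  have h : StrictAnti fun k => β (S.1.orderEmbOfFin S.2 k) :=
    fun _ _ h => hβ ((S.1.orderEmbOfFin S.2).strictMono h)
  have := sub_le_apply_of_strictAnti h k
  have := k.2
  simp only [pos, famPart]
  omega

theorem famPart_occ (hβ : StrictAnti β) (S : HalfSubset n) (p : ℕ) :
    (famPart β hβ S).occ p = decide (∃ i, β i = p ∧ i ∈ S.1) := by
  simp only [occ, famPart_pos, decide_eq_decide]
  constructor
  · rintro ⟨k, hk⟩
    exact ⟨_, hk, Finset.orderEmbOfFin_mem _ _ _⟩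
  · rintro ⟨i, hi, hS⟩
    rw [← Finset.mem_coe, ← Finset.range_orderEmbOfFin S.1 S.2] at hS
    obtain ⟨k, rfl⟩ := hS
    exact ⟨k, hi⟩

variable {A : Type*} [CommRing A] {k K : ℕ} {b : Fin k → ℕ}

/-- The state on `K` sites with one particle at each of the sites `b i`: of the first colour where
`z i` is true and of the second colour where `z i` is false. -/
def wordState (K : ℕ) (b : Fin k → ℕ) (z : Fin k → Bool) : Fin K → Occ := fun p =>
  (decide (∃ i, b i = p ∧ z i = true), decide (∃ i, b i = p ∧ z i = false))

/-- The indicator word of a half subset. -/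
def HalfSubset.word (S : HalfSubset n) (i : Fin (2 * n)) : Bool := decide (i ∈ S.1)

theorem pairState_famPart (hβ : StrictAnti β) (K : ℕ) (S : HalfSubset n) :
    pairState K (famPart β hβ S) (famPart β hβ S.compl) = wordState K β S.word := by
  funext p
  simp only [pairState, wordState, HalfSubset.word, famPart_occ, HalfSubset.compl, Finset.mem_compl,
    decide_eq_true_eq, decide_eq_false_iff_not]

theorem wordState_apply (hb : Function.Injective b) (z : Fin k → Bool) {p : Fin K} {i : Fin k}
    (hp : b i = p) : wordState K b z p = (z i, !z i) := by
  have h : ∀ c, (∃ j, b j = p ∧ z j = c) ↔ z i = c := fun c =>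
    ⟨fun ⟨j, hj, hz⟩ => by rw [← hb (hj.trans hp.symm), hz], fun hz => ⟨i, hp, hz⟩⟩
  simp only [wordState, h]
  cases z i <;> rfl

theorem wordState_eq_empty (z : Fin k → Bool) {p : Fin K} (hp : ∀ i, b i ≠ p) :
    wordState K b z p = Occ.empty := by
  simp [wordState, hp]

theorem update_wordState (hb : Function.Injective b) (z : Fin k → Bool) {p : Fin K} {i : Fin k}
    (hp : b i = p) :
    Function.update (wordState K b z) p (false, true) =
      wordState K b (Function.update z i false) := by
  funext q
  by_cases hq : ∃ j, b j = q
  · obtain ⟨j, hj⟩ := hq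
    rw [wordState_apply hb _ hj]
    obtain rfl | hji := eq_or_ne j i
    · simp [Fin.ext (hj.symm.trans hp)]
    · have hqp : q ≠ p := fun h => hji (hb (by rw [hj, h, hp]))
      rw [Function.update_of_ne hqp, Function.update_of_ne hji, wordState_apply hb _ hj]
  · push Not at hq
    have hqp : q ≠ p := fun h => hq i (by rw [h, hp])
    rw [Function.update_of_ne hqp, wordState_eq_empty _ hq, wordState_eq_empty _ hq]

/-- The eigenvalue of the Cartan element of `U_q(sl₂)` on a letter of a word. -/
def letterFactor (t : A) (c : Bool) : A := -t ^ c.toNat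

theorem cartan_letter (t : A) (c : Bool) : cartan t (c, !c) = letterFactor t c := by
  cases c <;> simp [cartan, letterFactor]

theorem cartan_empty (t : A) : cartan t Occ.empty = 1 := by
  simp [cartan]

/-- The raising operator of `U_q(sl₂)` on functions of a word, that is, on the `k`-th tensor power
of its two-dimensional representation. -/
def raiseFun (t : A) : ((Fin k → Bool) → A) →ₗ[A] (Fin k → Bool) → A :=
  LinearMap.pi fun z => ∑ i with z i = true,
    (∏ j with i < j, letterFactor t (z j)) • LinearMap.proj (Function.update z i false)

theorem raiseFun_apply (t : A) (f : (Fin k → Bool) → A) (z : Fin k → Bool) :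
    raiseFun t f z = ∑ i with z i = true,
      (∏ j with i < j, letterFactor t (z j)) * f (Function.update z i false) := by
  simp only [raiseFun, LinearMap.pi_apply, LinearMap.sum_apply, LinearMap.smul_apply,
    LinearMap.proj_apply, smul_eq_mul]

theorem prod_cartan_wordState (hb : StrictAnti b) (hK : ∀ i, b i < K) (t : A) (z : Fin k → Bool)
    (i : Fin k) :
    ∏ p : Fin K with p < ⟨b i, hK i⟩, cartan t (wordState K b z p) =
      ∏ j with i < j, letterFactor t (z j) := by
  refine (Finset.prod_of_injOn (fun j => ⟨b j, hK j⟩) ?_ ?_ ?_ ?_).symm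
  · exact fun j _ j' _ h => hb.injective (Fin.mk.inj h)
  · intro j hj
    simpa [hb.lt_iff_gt] using hj
  · intro p hp hpj
    rw [wordState_eq_empty, cartan_empty]
    rintro j hj
    obtain rfl : p = ⟨b j, hK j⟩ := Fin.ext hj.symm
    exact hpj ⟨j, by simpa [hb.lt_iff_gt] using hp, rfl⟩
  · intro j _
    rw [wordState_apply hb.injective z (i := j) rfl, cartan_letter]

theorem raiseFun_partitionFun (hb : StrictAnti b) (hK : ∀ i, b i < K) (t : A) {N : ℕ}
    (x : Fin N → A) {S₀ : Fin K → Occ} (hS₀ : ColorBalanced S₀) :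
    raiseFun t (fun z => partitionFun t x S₀ (wordState K b z)) = 0 := by
  funext z
  rw [Pi.zero_apply, ← hS₀.sum_cartan_mul_partitionFun t x (wordState K b z), raiseFun_apply]
  refine Finset.sum_of_injOn (fun i => ⟨b i, hK i⟩) ?_ ?_ ?_ ?_
  · exact fun j _ j' _ h => hb.injective (Fin.mk.inj h)
  · intro i hi
    simp_all [wordState_apply hb.injective z (i := i)]
  · intro p hp hpi
    by_cases h : ∃ i, b i = p
    · obtain ⟨i, hi⟩ := h
      simp only [Finset.mem_filter_univ, wordState_apply hb.injective z hi, Prod.mk.injEq] at hp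
      exact absurd ⟨i, by simpa using hp.1, Fin.ext hi⟩ hpi
    · push Not at h
      simp [wordState_eq_empty z h, Occ.empty] at hp
  · intro i _
    rw [prod_cartan_wordState hb hK, update_wordState hb.injective z rfl]

theorem colorBalanced_pairState (K : ℕ) {m : ℕ} (lam : FixedPartition m) :
    ColorBalanced (pairState K lam lam) := fun _ => rfl

end Words

section HighestWeight

variable {A : Type*} [CommRing A] (t : A) {k : ℕ}

/-- The number of letters `true` of a word. -/
def trueCount (z : Fin k → Bool) : ℕ := ∑ i, (z i).toNat

theorem trueCount_cons (b : Bool) (z : Fin k → Bool) :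
    trueCount (Fin.cons b z : Fin (k + 1) → Bool) = b.toNat + trueCount z := by
  simp only [trueCount, Fin.sum_univ_succ, Fin.cons_zero, Fin.cons_succ]

theorem trueCount_le (z : Fin k → Bool) : trueCount z ≤ k :=
  (Finset.sum_le_card_nsmul _ _ 1 fun i _ => (z i).toNat_le).trans (by simp)

theorem trueCount_update_true {z : Fin k → Bool} {i : Fin k} (hi : z i = false) :
    trueCount (Function.update z i true) = trueCount z + 1 := by
  have h : (fun j => (Function.update z i true j).toNat) =
      Function.update (fun j => (z j).toNat) i 1 :=
    funext fun j => Function.apply_update (fun _ => Bool.toNat) z i true j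
  rw [trueCount, h, Finset.sum_update_of_mem (Finset.mem_univ i), add_comm, trueCount,
    Finset.sum_eq_add_sum_sdiff_singleton_of_mem (Finset.mem_univ i), hi, Bool.toNat_false,
    zero_add]

/-- The eigenvalue of the Cartan element of `U_q(sl₂)` on a word. -/
def wordFactor (z : Fin k → Bool) : A := ∏ j, letterFactor t (z j)

theorem wordFactor_eq (z : Fin k → Bool) : wordFactor t z = (-1) ^ k * t ^ trueCount z := by
  simp only [wordFactor, letterFactor, Finset.prod_neg, Finset.prod_pow_eq_pow_sum, trueCount,
    Finset.card_univ, Fintype.card_fin]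

theorem wordFactor_update_true {z : Fin k → Bool} {i : Fin k} (hi : z i = false) :
    wordFactor t (Function.update z i true) = t * wordFactor t z := by
  rw [wordFactor_eq, wordFactor_eq, trueCount_update_true hi]
  ring

/-- The lowering operator of `U_q(sl₂)` on functions of a word. -/
def lowerFun : ((Fin k → Bool) → A) →ₗ[A] (Fin k → Bool) → A :=
  LinearMap.pi fun z => ∑ i with z i = false,
    (∏ j with j < i, letterFactor t (!z j)) • LinearMap.proj (Function.update z i true)

theorem lowerFun_apply (f : (Fin k → Bool) → A) (z : Fin k → Bool) :
    lowerFun t f z = ∑ i with z i = false,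
      (∏ j with j < i, letterFactor t (!z j)) * f (Function.update z i true) := by
  simp only [lowerFun, LinearMap.pi_apply, LinearMap.sum_apply, LinearMap.smul_apply,
    LinearMap.proj_apply, smul_eq_mul]

theorem lowerFun_wordFactor_mul (f : (Fin k → Bool) → A) :
    lowerFun t (wordFactor t * f) = t • (wordFactor t * lowerFun t f) := by
  funext z
  simp only [lowerFun_apply, Pi.mul_apply, Pi.smul_apply, smul_eq_mul, Finset.mul_sum]
  refine Finset.sum_congr rfl fun i hi => ?_
  rw [wordFactor_update_true t (Finset.mem_filter_univ i |>.1 hi)]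
  ring

/-- The restriction of a function of words of length `k + 1` to the words with first letter `b`. -/
def restrictHead (b : Bool) : ((Fin (k + 1) → Bool) → A) →ₗ[A] (Fin k → Bool) → A :=
  LinearMap.funLeft A A fun z => Fin.cons b z

theorem restrictHead_apply (b : Bool) (f : (Fin (k + 1) → Bool) → A) (z : Fin k → Bool) :
    restrictHead b f z = f (Fin.cons b z) := rfl

theorem restrictHead_ext {f g : (Fin (k + 1) → Bool) → A}
    (h : ∀ b, restrictHead b f = restrictHead b g) : f = g := by
  funext z
  rw [← Fin.cons_self_tail z]
  exact congrFun (h (z 0)) (Fin.tail z)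

theorem restrictHead_false_raiseFun (f : (Fin (k + 1) → Bool) → A) :
    restrictHead false (raiseFun t f) = raiseFun t (restrictHead false f) := by
  funext z
  simp [restrictHead_apply, raiseFun_apply, Finset.sum_filter, Finset.prod_filter,
    Fin.sum_univ_succ, Fin.prod_univ_succ, ← Fin.cons_update]

theorem restrictHead_true_raiseFun (f : (Fin (k + 1) → Bool) → A) :
    restrictHead true (raiseFun t f) =
      raiseFun t (restrictHead true f) + wordFactor t * restrictHead false f := by
  funext z
  simp [restrictHead_apply, raiseFun_apply, Finset.sum_filter, Finset.prod_filter,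
    Fin.sum_univ_succ, Fin.prod_univ_succ, ← Fin.cons_update, wordFactor, add_comm]

theorem restrictHead_true_lowerFun (f : (Fin (k + 1) → Bool) → A) :
    restrictHead true (lowerFun t f) = -lowerFun t (restrictHead true f) := by
  funext z
  simp [restrictHead_apply, lowerFun_apply, Finset.sum_filter, Finset.prod_filter,
    Fin.sum_univ_succ, Fin.prod_univ_succ, ← Fin.cons_update, letterFactor,
    ← Finset.sum_neg_distrib, neg_ite]

theorem restrictHead_false_lowerFun (f : (Fin (k + 1) → Bool) → A) :
    restrictHead false (lowerFun t f) =
      -t • lowerFun t (restrictHead false f) + restrictHead true f := by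
  funext z
  simp [restrictHead_apply, lowerFun_apply, Finset.sum_filter, Finset.prod_filter,
    Fin.sum_univ_succ, Fin.prod_univ_succ, ← Fin.cons_update, letterFactor,
    ← Finset.sum_neg_distrib, Finset.mul_sum, mul_assoc, neg_ite, add_comm]

/-- The eigenvalue of the commutator of the raising and the lowering operator on words of length
`k` with `c` letters `true`. -/
def weightEigenvalue (k c : ℕ) : A :=
  (-1) ^ (k + 1) * (∑ i ∈ Finset.range c, t ^ i - ∑ i ∈ Finset.range (k - c), t ^ i)

theorem weightEigenvalue_succ_succ (k c : ℕ) :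
    weightEigenvalue t (k + 1) (c + 1) = -weightEigenvalue t k c + (-1) ^ k * t ^ c := by
  simp only [weightEigenvalue, Nat.add_sub_add_right, Finset.sum_range_succ]
  ring

theorem weightEigenvalue_succ {c : ℕ} (hc : c ≤ k) :
    weightEigenvalue t (k + 1) c = -t * weightEigenvalue t k c - (-1) ^ k * t ^ c := by
  have hgeom (m : ℕ) : ∑ i ∈ Finset.range (m + 1), t ^ i = t * ∑ i ∈ Finset.range m, t ^ i + 1 :=
    geom_sum_succ
  have hpow := (geom_sum_succ' (x := t) (n := c)).symm.trans geom_sum_succ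
  simp only [weightEigenvalue, Nat.sub_add_comm hc, hgeom]
  linear_combination (-1) ^ k * hpow

theorem raiseFun_lowerFun (f : (Fin k → Bool) → A) :
    raiseFun t (lowerFun t f) =
      lowerFun t (raiseFun t f) + (fun z => weightEigenvalue t k (trueCount z)) * f := by
  induction k with
  | zero =>
    funext z
    simp [raiseFun_apply, lowerFun_apply, weightEigenvalue, trueCount]
  | succ k ih =>
    refine restrictHead_ext fun b => ?_
    cases b with
    | false =>
      rw [restrictHead_false_raiseFun, restrictHead_false_lowerFun, map_add, map_smul, ih,
        map_add, restrictHead_false_lowerFun, restrictHead_false_raiseFun,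
        restrictHead_true_raiseFun]
      funext z
      simp only [Pi.add_apply, Pi.mul_apply, Pi.smul_apply, smul_eq_mul, restrictHead_apply,
        trueCount_cons, Bool.toNat_false, zero_add, weightEigenvalue_succ t (trueCount_le z),
        wordFactor_eq]
      ring
    | true =>
      rw [restrictHead_true_raiseFun, restrictHead_true_lowerFun, restrictHead_false_lowerFun,
        map_neg, ih, map_add, restrictHead_true_lowerFun, restrictHead_true_raiseFun, map_add,
        lowerFun_wordFactor_mul]
      funext z
      simp only [Pi.add_apply, Pi.neg_apply, Pi.mul_apply, Pi.smul_apply, smul_eq_mul,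
        restrictHead_apply, trueCount_cons, Bool.toNat_true, add_comm 1,
        weightEigenvalue_succ_succ, wordFactor_eq]
      ring

/-- The function vanishes off the words with `c` letters `true`; `c` is an integer because
lowering a function supported on words without letters `true` leads to `c = -1`. -/
def SupportedOn (f : (Fin k → Bool) → A) (c : ℤ) : Prop := ∀ z, (trueCount z : ℤ) ≠ c → f z = 0

variable {t} {f : (Fin k → Bool) → A}

theorem SupportedOn.lowerFun {c : ℤ} (hf : SupportedOn f c) :
    SupportedOn (lowerFun t f) (c - 1) := by
  intro z hz
  rw [lowerFun_apply]
  refine Finset.sum_eq_zero fun i hi => ?_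
  rw [hf, mul_zero]
  rw [trueCount_update_true ((Finset.mem_filter_univ i).1 hi)]
  push_cast
  omega

theorem SupportedOn.iterate_lowerFun {c : ℤ} (hf : SupportedOn f c) (j : ℕ) :
    SupportedOn ((_root_.lowerFun t)^[j] f) (c - j) := by
  induction j with
  | zero => simpa using hf
  | succ j ih =>
    rw [Function.iterate_succ_apply', Nat.cast_succ, ← sub_sub]
    exact ih.lowerFun

theorem raiseFun_iterate_lowerFun {p : ℕ} (hf : SupportedOn f p) (h : raiseFun t f = 0) (j : ℕ) :
    raiseFun t ((lowerFun t)^[j + 1] f) =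
      (∑ i ∈ Finset.range (j + 1), weightEigenvalue t k (p - i)) • (lowerFun t)^[j] f := by
  have hweight (j : ℕ) : (fun z => weightEigenvalue t k (trueCount z)) * (lowerFun t)^[j] f =
      weightEigenvalue t k (p - j) • (lowerFun t)^[j] f := by
    funext z
    by_cases hz : (trueCount z : ℤ) = p - j
    · rw [Pi.mul_apply, Pi.smul_apply, smul_eq_mul, show trueCount z = p - j by omega]
    · rw [Pi.mul_apply, Pi.smul_apply, hf.iterate_lowerFun j z hz, mul_zero, smul_zero]
  induction j with
  | zero =>
    rw [Function.iterate_succ_apply', raiseFun_lowerFun, hweight, Function.iterate_zero_apply, h,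
      map_zero, zero_add, Finset.sum_range_one]
  | succ j ih =>
    rw [Function.iterate_succ_apply', raiseFun_lowerFun, hweight, ih, map_smul,
      ← Function.iterate_succ_apply' (lowerFun t) j f, ← add_smul, ← Finset.sum_range_succ]

theorem sum_weightEigenvalue_ne_zero (φ : A →+* ℤ) (ht : φ t = 1) {p : ℕ} (hp : 2 * p < k)
    (j : ℕ) : ∑ i ∈ Finset.range (j + 1), weightEigenvalue t k (p - i) ≠ 0 := by
  suffices h : φ (∑ i ∈ Finset.range (j + 1), weightEigenvalue t k (p - i)) ≠ 0 from
    fun h₀ => h (by rw [h₀, map_zero])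
  have hφ (i : ℕ) : φ (weightEigenvalue t k (p - i)) =
      (-1) ^ (k + 1) * (((p - i : ℕ) : ℤ) - ((k - (p - i) : ℕ) : ℤ)) := by
    simp [weightEigenvalue, ht]
  simp only [map_sum, hφ, ← Finset.mul_sum]
  refine mul_ne_zero (pow_ne_zero _ (by norm_num)) (ne_of_lt ?_)
  exact Finset.sum_neg (fun i _ => by omega) ⟨0, by simp⟩

theorem eq_zero_of_raiseFun_eq_zero [IsDomain A] (φ : A →+* ℤ) (ht : φ t = 1) {p : ℕ}
    (hp : 2 * p < k) (hf : SupportedOn f p) (h : raiseFun t f = 0) : f = 0 := by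
  classical
  have hex : ∃ j, (lowerFun t)^[j] f = 0 :=
    ⟨p + 1, funext fun z => hf.iterate_lowerFun (p + 1) z (by omega)⟩
  cases hj : Nat.find hex with
  | zero => exact (Nat.find_eq_zero hex).1 hj
  | succ j =>
    have hzero : (lowerFun t)^[j + 1] f = 0 := hj ▸ Nat.find_spec hex
    have hraise := raiseFun_iterate_lowerFun hf h j
    rw [hzero, map_zero, eq_comm, smul_eq_zero] at hraise
    exact absurd (hraise.resolve_left (sum_weightEigenvalue_ne_zero φ ht hp j))
      (Nat.find_min hex (by omega))

/-- The height after `m` steps of the path that goes down at the letters `true` and up at the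
letters `false`. -/
def height (z : Fin k → Bool) (m : ℕ) : ℤ :=
  ∑ i : Fin k with i.val < m, bif z i then -1 else 1

theorem height_zero (z : Fin k → Bool) : height z 0 = 0 := by
  simp [height]

theorem height_cons (b : Bool) (z : Fin k → Bool) (m : ℕ) :
    height (Fin.cons b z : Fin (k + 1) → Bool) (m + 1) =
      (bif b then -1 else 1) + height z m := by
  simp [height, Finset.sum_filter, Fin.sum_univ_succ]

theorem height_succ (z : Fin k → Bool) (i : Fin k) :
    height z (i + 1) = height z i + bif z i then -1 else 1 := by
  have h : Finset.univ.filter (fun j : Fin k => (j : ℕ) < i + 1) =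
      insert i (Finset.univ.filter fun j : Fin k => (j : ℕ) < i) := by
    ext j
    simp only [Finset.mem_filter_univ, Finset.mem_insert, Fin.ext_iff]
    omega
  rw [height, h, Finset.sum_insert (by simp), add_comm, height]

theorem height_of_le (z : Fin k → Bool) {m : ℕ} (hm : k ≤ m) : height z m = height z k := by
  simp only [height, fun i : Fin k => i.2.trans_le hm, Fin.is_lt]

theorem height_self (z : Fin k → Bool) : height z k = k - 2 * trueCount z := by
  have h (b : Bool) : (bif b then -1 else 1 : ℤ) = 1 - 2 * (b.toNat : ℤ) := by
    cases b <;> rfl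
  simp only [height, h, Fin.is_lt, Finset.filter_true, Finset.sum_sub_distrib, ← Finset.mul_sum,
    trueCount, Nat.cast_sum, Finset.sum_const, Finset.card_univ, Fintype.card_fin, nsmul_eq_mul,
    mul_one]

/-- The word has no suffix with more letters `false` than letters `true`. -/
def SuffixBallot (z : Fin k → Bool) : Prop := ∀ m, height z k ≤ height z m

theorem SuffixBallot.cons {z : Fin k → Bool} (hz : SuffixBallot z) {b : Bool}
    (hb : k + 1 ≤ 2 * (b.toNat + trueCount z)) :
    SuffixBallot (Fin.cons b z : Fin (k + 1) → Bool) := by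
  rintro (_ | m)
  · rw [height_zero, height_self, trueCount_cons]
    push_cast
    omega
  · rw [height_cons, height_cons]
    exact add_le_add_right (hz m) _

theorem SuffixBallot.le_two_mul_trueCount {z : Fin k → Bool} (hz : SuffixBallot z) :
    k ≤ 2 * trueCount z := by
  have := hz 0
  rw [height_zero, height_self] at this
  omega

theorem eq_zero_of_suffixBallot [IsDomain A] (φ : A →+* ℤ) (ht : φ t = 1) {p : ℕ}
    (hf : SupportedOn f p) (h : raiseFun t f = 0) (hz : ∀ z, SuffixBallot z → f z = 0) :
    f = 0 := by
  induction k generalizing p with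
  | zero => exact funext fun z => hz z fun m => (height_of_le z (Nat.zero_le m)).ge
  | succ k ih =>
    by_cases hp : 2 * p < k + 1
    · exact eq_zero_of_raiseFun_eq_zero φ ht hp hf h
    obtain ⟨p, rfl⟩ : ∃ q, p = q + 1 := ⟨p - 1, by omega⟩
    have hsupp (b : Bool) (z : Fin k → Bool) (hzp : b.toNat + trueCount z ≠ p + 1) :
        restrictHead b f z = 0 :=
      hf _ (by rw [trueCount_cons]; exact_mod_cast hzp)
    have hfalse : restrictHead false f = 0 := by
      refine ih (p := p + 1) (fun z hzp => hsupp false z (by simpa using mod_cast hzp)) ?_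
        fun z hb => ?_
      · rw [← restrictHead_false_raiseFun, h, map_zero]
      · by_cases hzp : false.toNat + trueCount z = p + 1
        · exact hz _ (hb.cons (by omega))
        · exact hsupp false z hzp
    have htrue : restrictHead true f = 0 := by
      refine ih (p := p) (fun z hzp => hsupp true z ?_) ?_ fun z hb => hz _ (hb.cons ?_)
      · rw [Bool.toNat_true]
        omega
      · have hr := restrictHead_true_raiseFun t f
        rwa [h, map_zero, hfalse, mul_zero, add_zero, eq_comm] at hr
      · have := hb.le_two_mul_trueCount
        rw [Bool.toNat_true]
        omega
    exact restrictHead_ext fun b => by cases b <;> simp only [hfalse, htrue, map_zero]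

end HighestWeight

section FacingSteps

variable {k : ℕ} {z : Fin k → Bool} {i i' j j' : Fin k}

/-- The up step `i` and the down step `j` of the path of a word face each other: the horizontal
line through the start of step `i` first meets the path again at the end of step `j`. -/
structure Faces (z : Fin k → Bool) (i j : Fin k) : Prop where
  lt : i < j
  height_eq : height z (j + 1) = height z i
  height_lt : ∀ m : ℕ, (i : ℕ) < m → m ≤ j → height z i < height z m

namespace Faces

theorem right_le (h : Faces z i j) (h' : Faces z i j') : j ≤ j' := by
  by_contra! hlt
  have hi : (i : ℕ) < j' + 1 := Nat.lt_succ_of_lt h'.lt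
  exact (h.height_lt (j' + 1) hi hlt).ne' h'.height_eq

theorem right_unique (h : Faces z i j) (h' : Faces z i j') : j = j' :=
  le_antisymm (h.right_le h') (h'.right_le h)

theorem left_le (h : Faces z i j) (h' : Faces z i' j) : i ≤ i' := by
  by_contra! hlt
  exact (h'.height_lt i hlt h.lt.le).ne (h'.height_eq.symm.trans h.height_eq)

theorem left_unique (h : Faces z i j) (h' : Faces z i' j) : i = i' :=
  le_antisymm (h.left_le h') (h'.left_le h)

theorem left_eq_false (h : Faces z i j) : z i = false := by
  have hlt := h.height_lt (i + 1) (Nat.lt_succ_self _) h.lt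
  rw [height_succ] at hlt
  cases hi : z i
  · rfl
  · simp [hi] at hlt

theorem right_eq_true (h : Faces z i j) : z j = true := by
  have hlt := h.height_lt j h.lt le_rfl
  rw [← h.height_eq, height_succ] at hlt
  cases hj : z j
  · simp [hj, Int.lt_iff_add_one_le] at hlt
  · rfl

end Faces

theorem exists_faces_right (hi : z i = false) (h : height z k ≤ height z i) :
    ∃ j, Faces z i j := by
  classical
  have hex : ∃ m, (i : ℕ) < m ∧ height z m ≤ height z i := ⟨k, i.2, h⟩
  obtain ⟨him, hm⟩ := Nat.find_spec hex
  have hmk : Nat.find hex ≤ k := Nat.find_min' hex ⟨i.2, h⟩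
  have hmin (m : ℕ) (him : (i : ℕ) < m) (hm : m < Nat.find hex) : height z i < height z m :=
    not_le.1 fun hle => Nat.find_min hex hm ⟨him, hle⟩
  obtain ⟨j, hj⟩ : ∃ j, Nat.find hex = j + 1 := ⟨Nat.find hex - 1, by omega⟩
  rw [hj] at him hm hmk hmin
  have hup := height_succ z i
  rw [hi, cond_false] at hup
  have hij : (i : ℕ) ≠ j := by
    rintro rfl
    omega
  have hdown := height_succ z ⟨j, hmk⟩
  have := hmin j (by omega) (Nat.lt_succ_self j)
  refine ⟨⟨j, hmk⟩, Fin.lt_def.2 (by simp only; omega), ?_,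
    fun m him hmj => hmin m him (Nat.lt_succ_of_le hmj)⟩
  cases hzj : z ⟨j, hmk⟩ <;> simp only [hzj, cond_false, cond_true] at hdown ⊢ <;> omega

theorem exists_faces_left (hj : z j = true) (h : 0 ≤ height z (j + 1)) : ∃ i, Faces z i j := by
  let P (m : ℕ) : Prop := height z m ≤ height z (j + 1)
  obtain ⟨i, hi⟩ : ∃ i, Nat.findGreatest P j = i := ⟨_, rfl⟩
  have hPi : height z i ≤ height z (j + 1) :=
    hi ▸ Nat.findGreatest_spec (P := P) (Nat.zero_le _) (by simpa only [P, height_zero] using h)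
  have hij : i ≤ j := hi ▸ Nat.findGreatest_le j
  have hmax (m : ℕ) (him : i < m) (hmj : m ≤ j) : height z (j + 1) < height z m :=
    not_le.1 (Nat.findGreatest_is_greatest (P := P) (hi ▸ him) hmj)
  have hdown := height_succ z j
  rw [hj, cond_true] at hdown
  have hij' : i < j := by
    refine lt_of_le_of_ne hij ?_
    rintro rfl
    omega
  have hup := height_succ z ⟨i, hij'.trans j.2⟩
  have := hmax (i + 1) (Nat.lt_succ_self i) hij'
  have heq : height z (j + 1) = height z i := by
    cases hzi : z ⟨i, hij'.trans j.2⟩ <;> simp only [hzi, cond_false, cond_true] at hup <;> omega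
  exact ⟨⟨i, hij'.trans j.2⟩, hij', heq, fun m him hmj => heq ▸ hmax m him hmj⟩

end FacingSteps

namespace NoncrossingMatching

variable {n : ℕ} (M : NoncrossingMatching n)

theorem partner_injective : Function.Injective M.partner :=
  Function.Involutive.injective M.partner_partner

theorem two_mul_sum {R : Type*} [NonAssocSemiring R] (f : Fin (2 * n) → R) :
    2 * ∑ i, f i = ∑ i, (f i + f (M.partner i)) := by
  have h : ∑ i, f (M.partner i) = ∑ i, f i :=
    Equiv.sum_comp (Function.Involutive.toPerm M.partner M.partner_partner) f
  rw [Finset.sum_add_distrib, h, two_mul]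

theorem not_partner_lt_iff {i : Fin (2 * n)} : ¬ M.partner i < i ↔ i < M.partner i :=
  not_lt.trans ⟨fun h => lt_of_le_of_ne h (M.partner_ne i).symm, le_of_lt⟩

/-- The two letters of the word at the ends of every arc are different. -/
def CompatWord (z : Fin (2 * n) → Bool) : Prop := ∀ i, z (M.partner i) = !z i

variable {M} in
theorem CompatWord.trueCount_eq {z : Fin (2 * n) → Bool} (hz : M.CompatWord z) :
    trueCount z = n := by
  have h : 2 * trueCount z = 2 * n := by
    rw [trueCount, M.two_mul_sum]
    have hpair (i : Fin (2 * n)) : (z i).toNat + (z (M.partner i)).toNat = 1 := by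
      rw [hz i]
      cases z i <;> rfl
    simp [hpair]
  omega

/-- The word marking the right end points of the arcs. -/
def rightEnds (i : Fin (2 * n)) : Bool := decide (M.partner i < i)

theorem compatWord_rightEnds : M.CompatWord M.rightEnds := by
  intro i
  rw [rightEnds, rightEnds, M.partner_partner, ← decide_not, decide_eq_decide]
  exact M.not_partner_lt_iff.symm

theorem height_rightEnds_self : height M.rightEnds (2 * n) = 0 := by
  rw [height_self, M.compatWord_rightEnds.trueCount_eq]
  push_cast
  ring

theorem height_rightEnds_nonneg (m : ℕ) : 0 ≤ height M.rightEnds m := by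
  have h : 0 ≤ 2 * height M.rightEnds m := by
    rw [height, Finset.sum_filter, M.two_mul_sum]
    refine Finset.sum_nonneg fun i _ => ?_
    rw [M.compatWord_rightEnds i]
    by_cases hi : M.partner i < i
    · have : (M.partner i : ℕ) < i := hi
      simp only [rightEnds, hi, decide_true, Bool.not_true, cond_true, cond_false]
      split_ifs <;> omega
    · have : (i : ℕ) < M.partner i := M.not_partner_lt_iff.1 hi
      simp only [rightEnds, hi, decide_false, Bool.not_false, cond_true, cond_false]
      split_ifs <;> omega
  omega

variable {M} {M' : NoncrossingMatching n}

theorem partner_lt_iff_of_rightEnds_eq (h : M.rightEnds = M'.rightEnds) (i : Fin (2 * n)) :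
    M.partner i < i ↔ M'.partner i < i := by
  simpa only [rightEnds, decide_eq_decide] using congrFun h i

theorem partner_le_partner_of_rightEnds_eq (h : M.rightEnds = M'.rightEnds) {j : Fin (2 * n)}
    (hind : ∀ i < j, M.partner i < i → M'.partner i = M.partner i) (hj : M.partner j < j) :
    M'.partner j ≤ M.partner j := by
  have hlt := partner_lt_iff_of_rightEnds_eq h
  by_contra! hnest
  have hj' : M'.partner j < j := (hlt j).1 hj
  -- The arc of `M` at `M'.partner j` starts there and ends before `j`, so `M'` has the same arc.
  have hleft : M'.partner j < M.partner (M'.partner j) := by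
    rw [← M.not_partner_lt_iff, hlt, M'.partner_partner]
    exact hj'.not_gt
  have hle := M.noncrossing _ _ hnest (by rwa [M.partner_partner])
  rw [M.partner_partner, not_lt] at hle
  have hne : M.partner (M'.partner j) ≠ j := fun he =>
    hnest.ne (by rw [← he, M.partner_partner, he])
  have hsame := hind _ (lt_of_le_of_ne hle hne) (by rwa [M.partner_partner])
  rw [M.partner_partner] at hsame
  exact hne (M'.partner_injective hsame)

theorem rightEnds_injective : Function.Injective (rightEnds : NoncrossingMatching n → _) := by
  intro M M' h
  have hlt := partner_lt_iff_of_rightEnds_eq h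
  have hright (j : Fin (2 * n)) : M.partner j < j → M'.partner j = M.partner j := by
    induction j using WellFoundedLT.induction with
    | ind j ih =>
      intro hj
      refine le_antisymm (partner_le_partner_of_rightEnds_eq h ih hj)
        (partner_le_partner_of_rightEnds_eq h.symm (fun i hij hi => ?_) ((hlt j).1 hj))
      exact (ih i hij ((hlt i).2 hi)).symm
  refine NoncrossingMatching.ext (funext fun i => ?_)
  by_cases hi : M.partner i < i
  · exact (hright i hi).symm
  · have hmate := hright (M.partner i)
      (by rw [M.partner_partner]; exact M.not_partner_lt_iff.1 hi)
    rw [M.partner_partner] at hmate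
    rw [← hmate, M'.partner_partner, hmate]

theorem exists_rightEnds_eq {z : Fin (2 * n) → Bool} (hz : ∀ m, 0 ≤ height z m)
    (hend : height z (2 * n) = 0) : ∃ M : NoncrossingMatching n, M.rightEnds = z := by
  have hright (i) (hi : z i = true) : ∃ j, Faces z j i := exists_faces_left hi (hz _)
  have hleft (i) (hi : z i = false) : ∃ j, Faces z i j := exists_faces_right hi (hend ▸ hz i)
  choose l hl using hright
  choose r hr using hleft
  let f (i : Fin (2 * n)) : Fin (2 * n) :=
    if hi : z i = true then l i hi else r i (by simpa using hi)
  have hf_true (i) (hi : z i = true) : Faces z (f i) i := by simp only [f, hi, dite_true, hl]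
  have hf_false (i) (hi : z i = false) : Faces z i (f i) := by simp [f, hi, hr]
  have hlt (i) (hi : i < f i) : z i = false := by
    by_contra hne
    exact hi.not_gt (hf_true i (by simpa using hne)).lt
  refine ⟨⟨f, fun i => ?_, fun i => ?_, fun i j hij hj hj' => ?_⟩, funext fun i => ?_⟩
  · cases hi : z i with
    | true => exact (hf_false _ (hf_true i hi).left_eq_false).right_unique (hf_true i hi)
    | false => exact (hf_true _ (hf_false i hi).right_eq_true).left_unique (hf_false i hi)
  · cases hi : z i with
    | true => exact (hf_true i hi).lt.ne
    | false => exact (hf_false i hi).lt.ne'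
  · have houter := hf_false i (hlt i (hij.trans hj))
    have hinner := hf_false j (hlt j (hj.trans hj'))
    have hlow := hinner.height_lt (f i + 1) (Nat.lt_succ_of_lt hj) hj'
    rw [houter.height_eq] at hlow
    exact lt_asymm hlow (houter.height_lt j hij hj.le)
  · cases hi : z i with
    | true => exact decide_eq_true (hf_true i hi).lt
    | false => exact decide_eq_false (hf_false i hi).lt.not_gt

end NoncrossingMatching

section Catalan

/-- The steps of the path of a word. -/
def dyckSteps {k : ℕ} (z : Fin k → Bool) : List DyckStep :=
  List.ofFn fun i => bif z i then DyckStep.D else DyckStep.U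

theorem length_dyckSteps {k : ℕ} (z : Fin k → Bool) : (dyckSteps z).length = k :=
  List.length_ofFn

theorem dyckSteps_injective {k : ℕ} :
    Function.Injective (dyckSteps : (Fin k → Bool) → List DyckStep) := by
  intro z z' h
  funext i
  have hi := congrFun (List.ofFn_injective h) i
  revert hi
  cases z i <;> cases z' i <;> simp

theorem exists_dyckSteps_eq {k : ℕ} {l : List DyckStep} (hl : l.length = k) :
    ∃ z : Fin k → Bool, dyckSteps z = l := by
  subst hl
  refine ⟨fun i => decide (l[i] = DyckStep.D), ?_⟩
  conv_rhs => rw [← List.ofFn_getElem (xs := l)]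
  refine congrArg List.ofFn (funext fun i => ?_)
  rcases DyckStep.dichotomy l[(i : ℕ)] with h | h <;> simp [h]

theorem count_take_dyckSteps {k : ℕ} (z : Fin k → Bool) (m : ℕ) :
    (((dyckSteps z).take m).count DyckStep.U : ℤ) - ((dyckSteps z).take m).count DyckStep.D =
      height z m := by
  induction k generalizing m with
  | zero => simp [dyckSteps, height]
  | succ k ih =>
    cases m with
    | zero => simp [height_zero]
    | succ m =>
      obtain ⟨b, z, rfl⟩ : ∃ b w, z = Fin.cons b w := ⟨_, _, (Fin.cons_self_tail z).symm⟩
      have hcons : dyckSteps (Fin.cons b z : Fin (k + 1) → Bool) =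
          (bif b then DyckStep.D else DyckStep.U) :: dyckSteps z := by
        simp [dyckSteps, List.ofFn_succ]
      rw [height_cons, ← ih, hcons, List.take_succ_cons, List.count_cons, List.count_cons]
      cases b <;> simp <;> ring

theorem count_dyckSteps {k : ℕ} (z : Fin k → Bool) :
    ((dyckSteps z).count DyckStep.U : ℤ) - (dyckSteps z).count DyckStep.D = height z k := by
  rw [← count_take_dyckSteps, List.take_of_length_le (length_dyckSteps z).le]

namespace NoncrossingMatching

variable {n : ℕ}

/-- The Dyck word of a non-crossing matching: up at left end points, down at right end points. -/
def dyckWord (M : NoncrossingMatching n) : DyckWord where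
  toList := dyckSteps M.rightEnds
  count_U_eq_count_D := by
    have := count_dyckSteps M.rightEnds
    have := M.height_rightEnds_self
    omega
  count_D_le_count_U m := by
    have := count_take_dyckSteps M.rightEnds m
    have := M.height_rightEnds_nonneg m
    omega

theorem semilength_dyckWord (M : NoncrossingMatching n) : M.dyckWord.semilength = n := by
  have h := M.dyckWord.two_mul_semilength_eq_length.trans (length_dyckSteps M.rightEnds)
  omega

theorem dyckWord_injective : Function.Injective (dyckWord : NoncrossingMatching n → DyckWord) :=
  fun _ _ h => rightEnds_injective (dyckSteps_injective (congrArg DyckWord.toList h))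

theorem exists_dyckWord_eq {p : DyckWord} (hp : p.semilength = n) :
    ∃ M : NoncrossingMatching n, M.dyckWord = p := by
  obtain ⟨z, hz⟩ := exists_dyckSteps_eq (l := p.toList) (k := 2 * n)
    (by rw [← DyckWord.two_mul_semilength_eq_length, hp])
  obtain ⟨M, rfl⟩ := exists_rightEnds_eq (z := z)
    (fun m => by
      rw [← count_take_dyckSteps, hz, sub_nonneg, Nat.cast_le]
      exact p.count_D_le_count_U m)
    (by rw [← count_dyckSteps, hz, p.count_U_eq_count_D, sub_self])
  exact ⟨M, DyckWord.ext hz⟩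

theorem card_eq_catalan (n : ℕ) : Nat.card (NoncrossingMatching n) = catalan n := by
  let f (M : NoncrossingMatching n) : {p : DyckWord // p.semilength = n} :=
    ⟨M.dyckWord, M.semilength_dyckWord⟩
  have hf : Function.Bijective f :=
    ⟨fun _ _ h => dyckWord_injective (congrArg Subtype.val h),
      fun p => (exists_dyckWord_eq p.2).imp fun _ hM => Subtype.ext hM⟩
  rw [Nat.card_congr (Equiv.ofBijective f hf), Nat.card_eq_fintype_card,
    DyckWord.card_dyckWord_semilength_eq_catalan]

end NoncrossingMatching

end Catalan

theorem prod_filter_lt_eq {ι R : Type*} [Fintype ι] [LinearOrder ι] [CommMonoid R] (f : ι → R)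
    {a b : ι} (hab : a < b) :
    ∏ j with a < j, f j = (∏ j with a < j ∧ j < b, f j) * (f b * ∏ j with b < j, f j) := by
  rw [← Finset.prod_filter_mul_prod_filter_not _ (· < b), Finset.filter_filter,
    Finset.filter_filter, ← Finset.prod_insert (a := b) (by simp)]
  congr 2
  ext j
  simp only [Finset.mem_filter_univ, not_lt, Finset.mem_insert, le_iff_eq_or_lt, eq_comm (a := b)]
  exact ⟨And.right, fun h => ⟨h.elim (fun h => h ▸ hab) hab.trans, h⟩⟩

theorem letterFactor_mul_not {A : Type*} [CommRing A] (t : A) (c : Bool) :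
    letterFactor t c * letterFactor t (!c) = t := by
  cases c <;> simp [letterFactor]

namespace NoncrossingMatching

variable {n : ℕ} (M : NoncrossingMatching n) {z : Fin (2 * n) → Bool} {a : Fin (2 * n)}
  {A : Type*} [CommRing A] (t : A)

instance (z : Fin (2 * n) → Bool) : Decidable (M.CompatWord z) :=
  inferInstanceAs (Decidable (∀ i, z (M.partner i) = !z i))

/-- The number of arcs strictly inside the arc with left end point `i`. -/
def nestedArcs (i : Fin (2 * n)) : ℕ :=
  Finset.card {j | (i < j ∧ j < M.partner i) ∧ j < M.partner j}

/-- The exponent of `t` with which a matching contributes to a compatible word. -/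
def wordExp (z : Fin (2 * n) → Bool) : ℕ :=
  ∑ i with z i = true ∧ i < M.partner i, (M.nestedArcs i + 1)

/-- The highest weight vector of a matching, in the tensor power of the two-dimensional
representation of `U_q(sl₂)`. -/
def wordVec (z : Fin (2 * n) → Bool) : A :=
  if M.CompatWord z then t ^ M.wordExp z else 0

theorem partner_mem_interval {j : Fin (2 * n)} (h : a < j ∧ j < M.partner a) :
    a < M.partner j ∧ M.partner j < M.partner a := by
  constructor
  · have hne : M.partner j ≠ a := fun he => h.2.ne (by rw [← he, M.partner_partner])
    by_contra! hle
    refine M.noncrossing (M.partner j) a (lt_of_le_of_ne hle hne) ?_ ?_ <;>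
      rw [M.partner_partner]
    exacts [h.1, h.2]
  · have hne : M.partner a ≠ M.partner j := fun he => h.1.ne (M.partner_injective he)
    by_contra! hle
    exact M.noncrossing a j h.1 h.2 (lt_of_le_of_ne hle hne)

theorem prod_letterFactor_interval
    (hz : ∀ j, j ≠ a → j ≠ M.partner a → z (M.partner j) = !z j) :
    ∏ j with a < j ∧ j < M.partner a, letterFactor t (z j) = t ^ M.nestedArcs a := by
  have hright : ∏ j with (a < j ∧ j < M.partner a) ∧ ¬ j < M.partner j, letterFactor t (z j) =
      ∏ j with (a < j ∧ j < M.partner a) ∧ j < M.partner j,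
        letterFactor t (z (M.partner j)) := by
    refine Finset.prod_nbij' M.partner M.partner ?_ ?_ (fun j _ => M.partner_partner j)
      (fun j _ => M.partner_partner j) fun j _ => by rw [M.partner_partner]
    · simp only [Finset.mem_filter_univ, M.partner_partner, not_lt]
      exact fun j hj => ⟨M.partner_mem_interval hj.1, lt_of_le_of_ne hj.2 (M.partner_ne j)⟩
    · simp only [Finset.mem_filter_univ, M.partner_partner, not_lt]
      exact fun j hj => ⟨M.partner_mem_interval hj.1, hj.2.le⟩
  rw [← Finset.prod_filter_mul_prod_filter_not _ fun j => j < M.partner j, Finset.filter_filter,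
    Finset.filter_filter, hright, ← Finset.prod_mul_distrib]
  refine Finset.prod_eq_pow_card fun j hj => ?_
  obtain ⟨⟨haj, hja⟩, -⟩ := (Finset.mem_filter_univ j).1 hj
  rw [hz j haj.ne' hja.ne, letterFactor_mul_not]

theorem compatWord_update_false_iff : M.CompatWord (Function.update z a false) ↔
    z (M.partner a) = true ∧ ∀ j, j ≠ a → j ≠ M.partner a → z (M.partner j) = !z j := by
  have hne {j : Fin (2 * n)} (hj : j ≠ M.partner a) : M.partner j ≠ a :=
    fun h => hj (by rw [← h, M.partner_partner])
  constructor
  · refine fun h => ⟨by simpa [M.partner_ne] using h a, fun j hja hjb => ?_⟩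
    simpa [hja, hne hjb] using h j
  · rintro ⟨hb, hz⟩ j
    obtain rfl | hja := eq_or_ne j a
    · simp [M.partner_ne, hb]
    obtain rfl | hjb := eq_or_ne j (M.partner a)
    · simp [M.partner_partner, M.partner_ne, hb]
    · simp [hja, hne hjb, hz j hja hjb]

theorem wordExp_update_partner (ha : a < M.partner a) (hza : z a = true) :
    M.wordExp (Function.update z (M.partner a) false) =
      M.wordExp (Function.update z a false) + (M.nestedArcs a + 1) := by
  rw [add_comm, wordExp, wordExp, ← Finset.sum_insert (f := fun i => M.nestedArcs i + 1) (by simp)]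
  congr 1
  ext i
  obtain rfl | hia := eq_or_ne i a
  · simp [ha, ha.ne, hza]
  obtain rfl | hib := eq_or_ne i (M.partner a)
  · simp [M.partner_partner, ha.ne', ha.le]
  · simp [hia, hib]

theorem raiseFun_wordVec_apply_of_lt (ha : a < M.partner a) (hza : z a = true)
    (hzb : z (M.partner a) = true)
    (hz : ∀ j, j ≠ a → j ≠ M.partner a → z (M.partner j) = !z j) :
    raiseFun t (M.wordVec t) z = 0 := by
  have hcompat_left : M.CompatWord (Function.update z a false) :=
    M.compatWord_update_false_iff.2 ⟨hzb, hz⟩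
  have hcompat_right : M.CompatWord (Function.update z (M.partner a) false) := by
    rw [compatWord_update_false_iff, M.partner_partner]
    exact ⟨hza, fun j hjb hja => hz j hja hjb⟩
  have hother (i) (hi : i ≠ a ∧ i ≠ M.partner a) :
      M.wordVec t (Function.update z i false) = 0 := by
    refine if_neg fun h => ?_
    have hpair := (M.compatWord_update_false_iff.1 h).2 a hi.1.symm
      fun he => hi.2 (by rw [he, M.partner_partner])
    simp [hza, hzb] at hpair
  rw [raiseFun_apply, Finset.sum_eq_add_of_mem a (M.partner a) (by simpa using hza)
    (by simpa using hzb) ha.ne fun i _ hi => by rw [hother i hi, mul_zero],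
    prod_filter_lt_eq _ ha, M.prod_letterFactor_interval t hz, wordVec, wordVec,
    if_pos hcompat_left, if_pos hcompat_right, M.wordExp_update_partner ha hza, hzb, letterFactor,
    Bool.toNat_true]
  ring

theorem raiseFun_wordVec : raiseFun t (M.wordVec t) = 0 := by
  funext z
  by_cases h : ∃ i, z i = true ∧ M.CompatWord (Function.update z i false)
  · obtain ⟨i, hi, hcompat⟩ := h
    obtain ⟨hp, hz⟩ := M.compatWord_update_false_iff.1 hcompat
    rcases lt_or_gt_of_ne (M.partner_ne i) with hlt | hlt
    · refine M.raiseFun_wordVec_apply_of_lt t (a := M.partner i) ?_ hp ?_ fun j hjb hja => ?_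
      · rwa [M.partner_partner]
      · rwa [M.partner_partner]
      · exact hz j (by rwa [M.partner_partner] at hja) hjb
    · exact M.raiseFun_wordVec_apply_of_lt t hlt hi hp hz
  · push Not at h
    rw [raiseFun_apply]
    refine Finset.sum_eq_zero fun i hi => ?_
    rw [wordVec, if_neg (h i ((Finset.mem_filter_univ i).1 hi)), mul_zero]

end NoncrossingMatching

section Expansion

variable {n : ℕ} {A : Type*} [CommRing A] {t : A}

theorem trueCount_update_false {k : ℕ} {z : Fin k → Bool} {i : Fin k} (hi : z i = true) :
    trueCount (Function.update z i false) + 1 = trueCount z := by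
  rw [← trueCount_update_true (Function.update_self i false z), Function.update_idem, ← hi,
    Function.update_eq_self]

theorem raiseFun_restrict_trueCount {k : ℕ} {f : (Fin k → Bool) → A} (h : raiseFun t f = 0)
    (p : ℕ) : raiseFun t (fun z => if trueCount z = p then f z else 0) = 0 := by
  funext z
  have hcount (i) (hi : i ∈ Finset.univ.filter fun i => z i = true) :
      trueCount (Function.update z i false) + 1 = trueCount z :=
    trueCount_update_false ((Finset.mem_filter_univ i).1 hi)
  rw [raiseFun_apply, Pi.zero_apply]
  by_cases hz : trueCount z = p + 1
  · rw [← Pi.zero_apply (M := fun _ => A) z, ← h, raiseFun_apply]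
    exact Finset.sum_congr rfl fun i hi => by rw [if_pos (by grind)]
  · exact Finset.sum_eq_zero fun i hi => by rw [if_neg (by grind), mul_zero]

theorem apply_eq_zero_of_rightEnds [IsDomain A] (φ : A →+* ℤ) (ht : φ t = 1)
    {f : (Fin (2 * n) → Bool) → A} (h : raiseFun t f = 0)
    (hM : ∀ M : NoncrossingMatching n, f M.rightEnds = 0) {z : Fin (2 * n) → Bool}
    (hz : trueCount z = n) : f z = 0 := by
  have hsupp : SupportedOn (fun z => if trueCount z = n then f z else 0) n :=
    fun z hz => if_neg (mod_cast hz)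
  have hzero := eq_zero_of_suffixBallot φ ht hsupp (raiseFun_restrict_trueCount h n)
    fun z hballot => ?_
  · simpa [hz] using congrFun hzero z
  · refine ite_eq_right_iff.2 fun hcount => ?_
    have hend : height z (2 * n) = 0 := by
      rw [height_self, hcount]
      push_cast
      ring
    obtain ⟨M, rfl⟩ := NoncrossingMatching.exists_rightEnds_eq (fun m => hend ▸ hballot m) hend
    exact hM M

namespace NoncrossingMatching

noncomputable instance : Fintype (NoncrossingMatching n) :=
  Fintype.ofInjective rightEnds rightEnds_injective

/-- The lexicographic order of the words of right end points. -/
noncomputable instance : LinearOrder (NoncrossingMatching n) :=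
  LinearOrder.lift' (fun M => toLex M.rightEnds) (toLex.injective.comp rightEnds_injective)

theorem CompatWord.toLex_rightEnds_le {M : NoncrossingMatching n} {z : Fin (2 * n) → Bool}
    (hz : M.CompatWord z) : toLex M.rightEnds ≤ toLex z := by
  by_contra! hlt
  obtain ⟨i, heq, hi⟩ := hlt
  obtain ⟨-, hri⟩ := Bool.lt_iff.1 hi
  have hp : z (M.partner i) = M.rightEnds (M.partner i) :=
    heq (M.partner i) (of_decide_eq_true hri)
  rw [hz i, M.compatWord_rightEnds i, Bool.not_inj_iff] at hp
  exact hi.ne hp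

/-- The values of the vectors of the matchings (columns) at the words of right end points
(rows). -/
def wordVecMatrix (n : ℕ) (t : A) : Matrix (NoncrossingMatching n) (NoncrossingMatching n) A :=
  Matrix.of fun M M' => M'.wordVec t M.rightEnds

theorem isLowerTriangular_wordVecMatrix (t : A) : (wordVecMatrix n t).IsLowerTriangular :=
  fun _ _ hlt => if_neg fun h => h.toLex_rightEnds_le.not_gt hlt

/-- The exponent of `t` in the determinant of `wordVecMatrix`. -/
noncomputable def detExp (n : ℕ) : ℕ := ∑ M : NoncrossingMatching n, M.wordExp M.rightEnds

theorem det_wordVecMatrix (t : A) : (wordVecMatrix n t).det = t ^ detExp n := by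
  rw [detExp, Matrix.det_of_isLowerTriangular _ (isLowerTriangular_wordVecMatrix t),
    ← Finset.prod_pow_eq_pow_sum]
  exact Finset.prod_congr rfl fun M _ => if_pos M.compatWord_rightEnds

theorem map_wordVecMatrix {B : Type*} [CommRing B] (φ : A →+* B) (t : A) :
    φ.mapMatrix (wordVecMatrix n t) = wordVecMatrix n (φ t) := by
  ext M M'
  simp only [wordVecMatrix, wordVec, RingHom.mapMatrix_apply, Matrix.map_apply, Matrix.of_apply,
    apply_ite φ, map_pow, map_zero]

/-- The coefficients in the expansion of a highest weight vector `f`, multiplied by the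
determinant of `wordVecMatrix`. -/
noncomputable def wordVecCoeff (t : A) (f : (Fin (2 * n) → Bool) → A) : NoncrossingMatching n → A :=
  (wordVecMatrix n t).adjugate.mulVec fun M => f M.rightEnds

theorem sum_wordVecCoeff_mul_wordVec_rightEnds (t : A) (f : (Fin (2 * n) → Bool) → A)
    (M : NoncrossingMatching n) :
    ∑ M', wordVecCoeff t f M' * M'.wordVec t M.rightEnds =
      t ^ detExp n * f M.rightEnds := by
  have h : (wordVecMatrix n t).mulVec (wordVecCoeff t f) =
      (wordVecMatrix n t).det • fun M => f M.rightEnds := by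
    rw [wordVecCoeff, Matrix.mulVec_mulVec, Matrix.mul_adjugate, Matrix.smul_mulVec,
      Matrix.one_mulVec]
  rw [← det_wordVecMatrix, ← smul_eq_mul]
  exact (Finset.sum_congr rfl fun M' _ => mul_comm _ _).trans (congrFun h M)

theorem sum_wordVecCoeff_mul_wordVec [IsDomain A] (φ : A →+* ℤ) (ht : φ t = 1)
    {f : (Fin (2 * n) → Bool) → A} (h : raiseFun t f = 0) {z : Fin (2 * n) → Bool}
    (hz : trueCount z = n) :
    ∑ M, wordVecCoeff t f M * M.wordVec t z =
      t ^ detExp n * f z := by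
  let D : (Fin (2 * n) → Bool) → A := ∑ M, wordVecCoeff t f M • M.wordVec t -
    t ^ detExp n • f
  have hD (z) : D z = ∑ M, wordVecCoeff t f M * M.wordVec t z -
      t ^ detExp n * f z := by
    simp only [D, Pi.sub_apply, Finset.sum_apply, Pi.smul_apply, smul_eq_mul]
  have hraise : raiseFun t D = 0 := by
    simp only [D, map_sub, map_sum, map_smul, raiseFun_wordVec, h, smul_zero,
      Finset.sum_const_zero, sub_zero]
  rw [← sub_eq_zero, ← hD]
  refine apply_eq_zero_of_rightEnds φ ht hraise (fun M => ?_) hz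
  rw [hD, sum_wordVecCoeff_mul_wordVec_rightEnds, sub_self]

theorem wordVecCoeff_isSymmetric {R : Type*} [CommRing R] (t : R) {N : ℕ}
    {f : (Fin (2 * n) → Bool) → MvPolynomial (Fin N) R}
    (hf : ∀ M : NoncrossingMatching n, (f M.rightEnds).IsSymmetric) (M : NoncrossingMatching n) :
    (wordVecCoeff (MvPolynomial.C t) f M).IsSymmetric := by
  have hadj (M' : NoncrossingMatching n) :
      ((wordVecMatrix n (MvPolynomial.C t)).adjugate M M' :
        MvPolynomial (Fin N) R).IsSymmetric := by
    rw [← map_wordVecMatrix, ← RingHom.map_adjugate, RingHom.mapMatrix_apply, Matrix.map_apply]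
    exact MvPolynomial.IsSymmetric.C _
  rw [← MvPolynomial.mem_symmetricSubalgebra]
  exact Subalgebra.sum_mem _ fun M' _ => Subalgebra.mul_mem _ (hadj M') (hf M')

end NoncrossingMatching

theorem trueCount_eq_card {k : ℕ} (z : Fin k → Bool) :
    trueCount z = Finset.card {i | z i = true} := by
  rw [Finset.card_filter]
  exact Finset.sum_congr rfl fun i _ => by cases z i <;> rfl

theorem HalfSubset.trueCount_word (S : HalfSubset n) : trueCount S.word = n := by
  simpa [trueCount_eq_card, word] using S.2

theorem HalfSubset.exists_word_eq {z : Fin (2 * n) → Bool} (hz : trueCount z = n) :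
    ∃ S : HalfSubset n, S.word = z :=
  ⟨⟨Finset.univ.filter fun i => z i = true, (trueCount_eq_card z).symm.trans hz⟩,
    funext fun i => by simp [word]⟩

theorem NoncrossingMatching.compatible_iff (M : NoncrossingMatching n) (S : HalfSubset n) :
    M.Compatible S ↔ M.CompatWord S.word := by
  simp only [Compatible, CompatWord, HalfSubset.word, ← decide_not, decide_eq_decide]

open FixedPartition in
theorem exists_raiseFun_eq_zero_and_LLT_eq {β : Fin (2 * n) → ℕ} (hβ : StrictAnti β) (N : ℕ) :
    ∃ f : (Fin (2 * n) → Bool) → MvPolynomial (Fin N) ℤ[X],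
      raiseFun (MvPolynomial.C Polynomial.X) f = 0 ∧
        ∀ S : HalfSubset n, LLT N (famPart β hβ S) (famPart β hβ S.compl) = f S.word := by
  have hK (i : Fin (2 * n)) : β i < ∑ i, β i + 1 :=
    Nat.lt_succ_of_le (Finset.single_le_sum (fun _ _ => Nat.zero_le _) (Finset.mem_univ i))
  refine ⟨_, raiseFun_partitionFun hβ hK (MvPolynomial.C Polynomial.X) MvPolynomial.X
    (colorBalanced_pairState _ (0 : FixedPartition n)), fun S => ?_⟩
  rw [← pairState_famPart hβ]
  exact LLT_eq_partitionFun N (fun i => famPart_pos hβ S i ▸ hK _)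
    fun i => famPart_pos hβ S.compl i ▸ hK _

theorem exists_X_pow_mul_LLT_eq_sum {β : Fin (2 * n) → ℕ} (hβ : StrictAnti β)
    (N : ℕ) : ∃ g : NoncrossingMatching n → MvPolynomial (Fin N) ℤ[X], (∀ M, (g M).IsSymmetric) ∧
      ∀ S : HalfSubset n,
        MvPolynomial.C (Polynomial.X ^ NoncrossingMatching.detExp n) *
            LLT N (famPart β hβ S) (famPart β hβ S.compl) =
          ∑ M : NoncrossingMatching n with M.Compatible S,
            MvPolynomial.C (Polynomial.X ^ M.wordExp S.word) * g M := by
  obtain ⟨f, hraise, hf⟩ := exists_raiseFun_eq_zero_and_LLT_eq hβ N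
  let φ : MvPolynomial (Fin N) ℤ[X] →+* ℤ :=
    MvPolynomial.eval₂Hom (Polynomial.evalRingHom 1) 0
  have hφ : φ (MvPolynomial.C Polynomial.X) = 1 := by
    simp [φ]
  refine ⟨NoncrossingMatching.wordVecCoeff (MvPolynomial.C Polynomial.X) f,
    NoncrossingMatching.wordVecCoeff_isSymmetric Polynomial.X fun M => ?_, fun S => ?_⟩
  · obtain ⟨S, hS⟩ := HalfSubset.exists_word_eq M.compatWord_rightEnds.trueCount_eq
    rw [← hS, ← hf]
    exact LLT_isSymmetric N _ _
  · rw [hf, map_pow, ← NoncrossingMatching.sum_wordVecCoeff_mul_wordVec φ hφ hraise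
      S.trueCount_word, Finset.sum_filter]
    refine Finset.sum_congr rfl fun M _ => ?_
    rw [mul_comm]
    simp only [NoncrossingMatching.wordVec, M.compatible_iff, map_pow, ite_mul, zero_mul]

end Expansion

theorem C_T_mul_toLaurentCoeffs {N : ℕ} (m d : ℕ) (p : MvPolynomial (Fin N) ℤ[X]) :
    MvPolynomial.C (LaurentPolynomial.T (-d : ℤ)) *
        toLaurentCoeffs N (MvPolynomial.C (Polynomial.X ^ m) * p) =
      MvPolynomial.C (LaurentPolynomial.T (m - d : ℤ)) * toLaurentCoeffs N p := by
  rw [map_mul, ← mul_assoc, toLaurentCoeffs, MvPolynomial.map_C, Polynomial.toLaurent_X_pow,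
    ← map_mul, ← LaurentPolynomial.T_add, neg_add_eq_sub]

theorem mainTheorem2 (n : ℕ) (β : Fin (2 * n) → ℕ) (hβ : StrictAnti β) :
    ∃ (M : Fin (catalan n) ≃ NoncrossingMatching n)
      (e : Fin (catalan n) → HalfSubset n → ℤ),
      ∀ N : ℕ, ∃ g : Fin (catalan n) → MvPolynomial (Fin N) (Polynomial ℤ),
        (∀ j, (g j).IsSymmetric) ∧
        ∀ S : HalfSubset n,
          toLaurentCoeffs N (LLT N (famPart β hβ S) (famPart β hβ S.compl)) =
            ∑ j : Fin (catalan n) with (M j).Compatible S,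
              MvPolynomial.C (LaurentPolynomial.T (e j S)) * toLaurentCoeffs N (g j) := by
  let M := (Finite.equivFinOfCardEq (NoncrossingMatching.card_eq_catalan n)).symm
  let d := NoncrossingMatching.detExp n
  refine ⟨M, fun j S => (M j).wordExp S.word - d, fun N => ?_⟩
  obtain ⟨g, hsymm, hg⟩ := exists_X_pow_mul_LLT_eq_sum hβ N
  refine ⟨fun j => g (M j), fun j => hsymm (M j), fun S => ?_⟩
  have hsum := congrArg
    (MvPolynomial.C (LaurentPolynomial.T (-d : ℤ)) * toLaurentCoeffs N ·) (hg S)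
  simp only [map_sum, Finset.mul_sum, C_T_mul_toLaurentCoeffs] at hsum
  rw [sub_self, LaurentPolynomial.T_zero, map_one, one_mul] at hsum
  rw [hsum, Finset.sum_filter, Finset.sum_filter]
  exact (Equiv.sum_comp M _).symm
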